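/- Conventions. For $n\ge 1$, $c\in\mathbb{Q}_{\ge0}^n$, a finite set $B\subseteq[0,1]^n$ and $x\in[0,1]^n$ let $c_B(x)=\min\{c^{\top}b : b\in B,\ x\le b\}$ (and $c_B(x)=\infty$ if no $b\in B$ satisfies $x\le b$ coordinatewise). A finite set $B$ is a Pareto cover of a probability measure $\mu$ on $[0,1]^n$ if $\mu(\{x : x\le b\text{ for some }b\in B\})=1$. Given $\mu,c$ and $k\ge1$, the feasible solutions are the Pareto covers $B\subseteq[0,1]^n$ of $\mu$ with $|B|=k$; $\mathrm{OPT}$ is the infimum of $\mathrm{E}_\mu[c_B]$ over them; $B$ is an $r$-approximate solution if it is feasible and $\mathrm{E}_\mu[c_B]\le r\cdot\mathrm{OPT}$. A probability measure $\mu$ on $[0,1]$ is nice if it has an oracle $\sigma$ which, for all rationals $-1\le a<b\le1$ and $\delta\in(0,1)$, returns, in time polynomial in the encoding lengths of $a,b,\delta$, a rational $\sigma(a,b,\delta)\ge0$ with $(1+\delta)^{-1}\mu((a,b]\cap[0,1])\le\sigma(a,b,\delta)\le(1+\delta)\,\mu((a,b]\cap[0,1])$. An instance $I$ of the general Pareto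 cover problem consists of $n\ge1$, oracles $\sigma_1,\dots,\sigma_n$ for nice measures $\mu_1,\dots,\mu_n$ on $[0,1]$, $c\in\mathbb{Q}^n_{\ge0}$, an integer $k\ge1$ and a rational $\alpha\in(0,1)$ with $\alpha\le\mathrm{E}_{X\sim\mu_i}[X]$ for all $i$; its measure is $\prod_i\mu_i$. Algorithms access the $\mu_i$ only by querying the $\sigma_i$, a query is charged the running time of the oracle, and $\mathrm{size}(I)$ is the binary encoding length of $n,k,\alpha,c$ (the oracles count $0$). An instance of the discrete Pareto cover problem consists of $M\ge0$, rationals $0=a_0<a_1<\dots<a_{M+1}=1$, rationals $p^i_j\in[0,1]$ with $\sum_{j=0}^{M+1}p^i_j=1$ for $i=1,\dots,n$, $c\in\mathbb{Q}^n_{\ge0}$ and an integer $k\ge1$; its measure is the product of the measures $\sum_j p^i_j\,\delta_{a_j}$. Theorem. Let $I$ be an instance of the general Pareto cover problem and let $\gamma>0$ be rational. Put $\epsilon=\frac{\min\{\gamma,1\}}{60n}$, $M=\lceil\log_{1+\epsilon}((\epsilon\alpha)^{-1})\rceil$, $q_{-1}=-1$, $q_0=0$, $q_\ell=\epsilon\alpha(1+\epsilon)^{\ell-1}$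 for $1\le\ell\le M$, $q_{M+1}=1$, and $$p^i_\ell=\frac{\sigma_i(q_{\ell-1},q_\ell,\epsilon)}{\sum_{t=0}^{M+1}\sigma_i(q_{t-1},q_t,\epsilon)}\qquad(1\le i\le n,\ 0\le\ell\le M+1).$$ Then $I_\gamma=(M,(q_\ell)_{\ell=0}^{M+1},(p^i_\ell),c,k)$ is an instance of the discrete Pareto cover problem, and every $(1+\frac{\gamma}{15})$-approximate solution to $I_\gamma$ is a $(1+\gamma)$-approximate solution to $I$. Moreover, a single algorithm computes $I_\gamma$ from every input $(I,\gamma)$ in time polynomial in $\gamma^{-1}$ and in the encoding length of the input, that is, $\mathrm{size}(I)$ plus the encoding length of $\gamma$: for every polynomial $P$ there is a polynomial $T$ such that, whenever the oracles of $I$ run in time $P$ (in the encoding length of the query), the running time is at most $T(\lceil\gamma^{-1}\rceil+\mathrm{size}(I)+\mathrm{size}(\gamma))$. -/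

import Mathlib

open MeasureTheory
open scoped ENNReal

namespace ParetoCover

noncomputable section

/-! ## Pareto covers of measures on the cube -/

/-- `μ`-almost every point of `[0,1]^n` lies below some point of `B`. -/
def IsParetoCover {n : ℕ} (μ : Measure (Fin n → unitInterval))
    (B : Finset (Fin n → unitInterval)) : Prop :=
  μ {x | ∃ b ∈ B, x ≤ b} = 1

/-- `c_B(x) = min {∑ i, c i * b i : b ∈ B, x ≤ b}`, and `∞` if no point of `B` covers `x`. -/
def coverCost {n : ℕ} (c : Fin n → ℚ) (B : Finset (Fin n → unitInterval))
    (x : Fin n → unitInterval) : ℝ≥0∞ :=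
  ⨅ b ∈ B, ⨅ _ : x ≤ b, ENNReal.ofReal (∑ i, (c i : ℝ) * (b i : ℝ))

/-- The expectation of `c_B`. -/
def expectedCost {n : ℕ} (μ : Measure (Fin n → unitInterval)) (c : Fin n → ℚ)
    (B : Finset (Fin n → unitInterval)) : ℝ≥0∞ :=
  ∫⁻ x, coverCost c B x ∂μ

/-- Feasible solutions: Pareto covers with exactly `k` points. -/
def IsSolution {n : ℕ} (μ : Measure (Fin n → unitInterval)) (k : ℕ)
    (B : Finset (Fin n → unitInterval)) : Prop :=
  B.card = k ∧ IsParetoCover μ B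

/-- The optimum value. -/
def optCost {n : ℕ} (μ : Measure (Fin n → unitInterval)) (c : Fin n → ℚ) (k : ℕ) : ℝ≥0∞ :=
  ⨅ (B : Finset (Fin n → unitInterval)) (_ : IsSolution μ k B), expectedCost μ c B

/-- `B` is feasible and its cost is at most `r` times the optimum. -/
def IsApproxSolution {n : ℕ} (μ : Measure (Fin n → unitInterval)) (c : Fin n → ℚ) (k : ℕ)
    (r : ℝ) (B : Finset (Fin n → unitInterval)) : Prop :=
  IsSolution μ k B ∧ expectedCost μ c B ≤ ENNReal.ofReal r * optCost μ c k

/-! ## Encoding lengths and oracles -/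

/-- Binary encoding length of a rational number: sign, numerator and denominator
(`Nat.size m` is the number of binary digits of `m`). -/
def ratSize (q : ℚ) : ℕ := 1 + Nat.size q.num.natAbs + Nat.size q.den

/-- A black box: `ans a b δ` is the answer to the query `(a, b, δ)`, and `time a b δ` is the time
the black box needs to answer. -/
structure Oracle where
  ans : ℚ → ℚ → ℚ → ℚ
  time : ℚ → ℚ → ℚ → ℕ

/-- The queries an oracle admits. -/
def ValidQuery (a b δ : ℚ) : Prop := -1 ≤ a ∧ a < b ∧ b ≤ 1 ∧ 0 < δ ∧ δ < 1

/-- On admissible queries, the answers are nonnegative and approximate `μ ((a, b] ∩ [0, 1])`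
within a factor of `1 + δ`. -/
def Oracle.Approximates (σ : Oracle) (μ : Measure unitInterval) : Prop :=
  ∀ a b δ : ℚ, ValidQuery a b δ →
    0 ≤ σ.ans a b δ ∧
    (1 + (δ : ℝ))⁻¹ * μ.real {x : unitInterval | (a : ℝ) < x ∧ (x : ℝ) ≤ b} ≤ (σ.ans a b δ : ℝ) ∧
    (σ.ans a b δ : ℝ) ≤ (1 + (δ : ℝ)) * μ.real {x : unitInterval | (a : ℝ) < x ∧ (x : ℝ) ≤ b}

/-- On admissible queries, the time is bounded by the polynomial `P` in the encoding length of the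
query; writing down the answer is part of the time. -/
def Oracle.RunsWithin (σ : Oracle) (P : Polynomial ℕ) : Prop :=
  ∀ a b δ : ℚ, ValidQuery a b δ →
    ratSize (σ.ans a b δ) ≤ σ.time a b δ ∧
    σ.time a b δ ≤ P.eval (ratSize a + ratSize b + ratSize δ)

/-- `σ` witnesses that `μ` is a nice measure. -/
def Oracle.IsNiceFor (σ : Oracle) (μ : Measure unitInterval) : Prop :=
  σ.Approximates μ ∧ ∃ P : Polynomial ℕ, σ.RunsWithin P

/-! ## Instances -/

/-- Instances of the general Pareto cover problem in dimension `n`. -/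
structure Instance (n : ℕ) where
  μ : Fin n → Measure unitInterval
  isProb : ∀ i, IsProbabilityMeasure (μ i)
  oracle : Fin n → Oracle
  nice : ∀ i, (oracle i).IsNiceFor (μ i)
  c : Fin n → ℚ
  c_nonneg : ∀ i, 0 ≤ c i
  k : ℕ
  one_le_k : 1 ≤ k
  α : ℚ
  α_pos : 0 < α
  α_lt_one : α < 1
  α_le : ∀ i, (α : ℝ) ≤ ∫ x, (x : ℝ) ∂(μ i)

/-- The product measure of the instance. -/
def Instance.measure {n : ℕ} (I : Instance n) : Measure (Fin n → unitInterval) :=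
  Measure.pi I.μ

/-- Binary encoding length of the instance; the oracles contribute nothing. -/
def Instance.size {n : ℕ} (I : Instance n) : ℕ :=
  Nat.size n + Nat.size I.k + ratSize I.α + ∑ i, ratSize (I.c i)

/-- Instances of the discrete Pareto cover problem in dimension `n`. -/
structure DiscreteInstance (n : ℕ) where
  M : ℕ
  a : Fin (M + 2) → ℚ
  a_strictMono : StrictMono a
  a_zero : a 0 = 0
  a_last : a (Fin.last (M + 1)) = 1
  p : Fin n → Fin (M + 2) → ℚ
  p_mem : ∀ i j, p i j ∈ Set.Icc (0 : ℚ) 1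
  p_sum : ∀ i, ∑ j, p i j = 1
  c : Fin n → ℚ
  c_nonneg : ∀ i, 0 ≤ c i
  k : ℕ
  one_le_k : 1 ≤ k

theorem DiscreteInstance.a_mem {n : ℕ} (J : DiscreteInstance n) (j : Fin (J.M + 2)) :
    (J.a j : ℝ) ∈ unitInterval := by
  have h0 : J.a 0 ≤ J.a j := J.a_strictMono.monotone (Fin.zero_le j)
  have h1 : J.a j ≤ J.a (Fin.last (J.M + 1)) := J.a_strictMono.monotone (Fin.le_last j)
  rw [J.a_zero] at h0
  rw [J.a_last] at h1
  exact ⟨by exact_mod_cast h0, by exact_mod_cast h1⟩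

/-- The distribution of coordinate `i`: mass `p i j` at the point `a j`. -/
def DiscreteInstance.marginal {n : ℕ} (J : DiscreteInstance n) (i : Fin n) :
    Measure unitInterval :=
  ∑ j, ENNReal.ofReal (J.p i j : ℝ) • Measure.dirac (⟨(J.a j : ℝ), J.a_mem j⟩ : unitInterval)

/-- The product of the marginal distributions. -/
def DiscreteInstance.measure {n : ℕ} (J : DiscreteInstance n) :
    Measure (Fin n → unitInterval) :=
  Measure.pi J.marginal

/-! ## The reduced instance -/

/-- `M = ⌈log_{1+ε} (1 / (ε α))⌉`. -/
def queryCount (ε α : ℚ) : ℕ := ⌈Real.logb (1 + (ε : ℝ)) ((ε : ℝ) * α)⁻¹⌉₊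

/-- The query coordinates `q_0 = 0`, `q_l = ε α (1+ε)^(l-1)` for `1 ≤ l ≤ M`, `q_{M+1} = 1`. -/
def queryCoord (ε α : ℚ) (l : ℕ) : ℚ :=
  if l = 0 then 0
  else if l ≤ queryCount ε α then ε * α * (1 + ε) ^ (l - 1)
  else 1

/-- `q_{l-1}`, where `q_{-1} = -1`. -/
def queryPrev (ε α : ℚ) (l : ℕ) : ℚ := if l = 0 then -1 else queryCoord ε α (l - 1)

/-- The oracle's approximation of the mass of `(q_{l-1}, q_l]`. -/
def queryWeight (σ : Oracle) (ε α : ℚ) (l : ℕ) : ℚ :=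
  σ.ans (queryPrev ε α l) (queryCoord ε α l) ε

/-- The accuracy that belongs to the parameter `γ` in dimension `n`. -/
def accuracy (n : ℕ) (γ : ℚ) : ℚ := min γ 1 / (60 * n)

/-- `J` is the discrete instance with the query coordinates as grid, the normalized oracle answers
as probabilities, and the costs and the cover size of `I`. -/
structure IsReducedInstance {n : ℕ} (I : Instance n) (γ : ℚ) (J : DiscreteInstance n) :
    Prop where
  k_eq : J.k = I.k
  c_eq : J.c = I.c
  M_eq : J.M = queryCount (accuracy n γ) I.α
  a_eq : ∀ j, J.a j = queryCoord (accuracy n γ) I.α j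
  p_eq : ∀ i j, J.p i j =
    queryWeight (I.oracle i) (accuracy n γ) I.α j /
      ∑ t ∈ Finset.range (queryCount (accuracy n γ) I.α + 2),
        queryWeight (I.oracle i) (accuracy n γ) I.α t

/-! ## Oracle programs and their bit cost

A random access machine with finitely many arrays of rational numbers, in logarithmic cost: every
operation is charged the encoding lengths of the numbers that it handles. -/

/-- The memory: `s A l` is entry `l` of array `A`. -/
abbrev Store := ℕ → ℕ → ℚ

/-- Expressions. The array of a `read` is fixed in the program, its position is computed. -/
inductive Expr where
  | lit (q : ℚ)
  | read (arr : ℕ) (pos : Expr)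
  | add (x y : Expr)
  | sub (x y : Expr)
  | mul (x y : Expr)
  | div (x y : Expr)
  | floor (x : Expr)

/-- The value of an expression. -/
def Expr.val (s : Store) : Expr → ℚ
  | .lit q => q
  | .read A e => s A ⌊e.val s⌋₊
  | .add x y => x.val s + y.val s
  | .sub x y => x.val s - y.val s
  | .mul x y => x.val s * y.val s
  | .div x y => x.val s / y.val s
  | .floor x => (⌊x.val s⌋ : ℚ)

/-- The bit cost of evaluating an expression: the total encoding length of all the values that
occur in the evaluation. -/
def Expr.cost (s : Store) : Expr → ℕ
  | .lit q => ratSize q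
  | .read A e => e.cost s + ratSize (s A ⌊e.val s⌋₊)
  | .add x y => x.cost s + y.cost s + ratSize (x.val s + y.val s)
  | .sub x y => x.cost s + y.cost s + ratSize (x.val s - y.val s)
  | .mul x y => x.cost s + y.cost s + ratSize (x.val s * y.val s)
  | .div x y => x.cost s + y.cost s + ratSize (x.val s / y.val s)
  | .floor x => x.cost s + ratSize (⌊x.val s⌋ : ℚ)

/-- Programs. `write A e x` stores `x` at position `e` of array `A`; `ite` and `loop` test whether
the value of an expression is positive; `query A e i a b δ` stores the answer of oracle number `i`
to the query `(a, b, δ)` at position `e` of array `A`. -/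
inductive Program where
  | skip
  | write (arr : ℕ) (pos x : Expr)
  | query (arr : ℕ) (pos i a b δ : Expr)
  | seq (P Q : Program)
  | ite (test : Expr) (P Q : Program)
  | loop (test : Expr) (P : Program)

/-- The memory after storing `q` at position `l` of array `A`. -/
def Store.set (s : Store) (A l : ℕ) (q : ℚ) : Store :=
  Function.update s A (Function.update (s A) l q)

/-- `Exec σ P s s' t`: with access to the oracles `σ`, the program `P`, started on the memory `s`,
halts with the memory `s'` at total cost `t`. Only admissible queries can be executed, and a query
is charged the time of the oracle. -/
inductive Exec {n : ℕ} (σ : Fin n → Oracle) : Program → Store → Store → ℕ → Prop where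
  | skip (s : Store) : Exec σ .skip s s 1
  | write (s : Store) (A : ℕ) (e x : Expr) :
      Exec σ (.write A e x) s (s.set A ⌊e.val s⌋₊ (x.val s)) (1 + e.cost s + x.cost s)
  | query (s : Store) (A : ℕ) (e i a b δ : Expr) (m : Fin n) (hm : i.val s = ((m : ℕ) : ℚ))
      (hq : ValidQuery (a.val s) (b.val s) (δ.val s)) :
      Exec σ (.query A e i a b δ) s
        (s.set A ⌊e.val s⌋₊ ((σ m).ans (a.val s) (b.val s) (δ.val s)))
        (1 + e.cost s + i.cost s + a.cost s + b.cost s + δ.cost s +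
          (σ m).time (a.val s) (b.val s) (δ.val s))
  | seq {P Q : Program} {s s₁ s₂ : Store} {t₁ t₂ : ℕ} :
      Exec σ P s s₁ t₁ → Exec σ Q s₁ s₂ t₂ → Exec σ (.seq P Q) s s₂ (1 + t₁ + t₂)
  | ite_true {e : Expr} {P Q : Program} {s s₁ : Store} {t : ℕ} :
      0 < e.val s → Exec σ P s s₁ t → Exec σ (.ite e P Q) s s₁ (1 + e.cost s + t)
  | ite_false {e : Expr} {P Q : Program} {s s₁ : Store} {t : ℕ} :
      e.val s ≤ 0 → Exec σ Q s s₁ t → Exec σ (.ite e P Q) s s₁ (1 + e.cost s + t)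
  | loop_true {e : Expr} {P : Program} {s s₁ s₂ : Store} {t₁ t₂ : ℕ} :
      0 < e.val s → Exec σ P s s₁ t₁ → Exec σ (.loop e P) s₁ s₂ t₂ →
      Exec σ (.loop e P) s s₂ (1 + e.cost s + t₁ + t₂)
  | loop_false {e : Expr} {P : Program} {s : Store} :
      e.val s ≤ 0 → Exec σ (.loop e P) s s (1 + e.cost s)

/-- The initial memory: `n, k, α, γ` in array `0`, the costs in array `1`, zeros elsewhere. -/
def inputStore {n : ℕ} (I : Instance n) (γ : ℚ) : Store
  | 0, 0 => n
  | 0, 1 => I.k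
  | 0, 2 => I.α
  | 0, 3 => γ
  | 1, l => if h : l < n then I.c ⟨l, h⟩ else 0
  | _, _ => 0

/-- The memory holds the discrete instance `J`: `n, k, M` in array `2`, the grid in array `3`, the
probabilities, row by row, in array `4`, and the costs in array `5`. -/
structure Store.Holds {n : ℕ} (s : Store) (J : DiscreteInstance n) : Prop where
  n_eq : s 2 0 = n
  k_eq : s 2 1 = J.k
  M_eq : s 2 2 = J.M
  a_eq : ∀ j : Fin (J.M + 2), s 3 j = J.a j
  p_eq : ∀ (i : Fin n) (j : Fin (J.M + 2)), s 4 (i * (J.M + 2) + j) = J.p i j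
  c_eq : ∀ i : Fin n, s 5 i = J.c i

end

end ParetoCover

/-!
Rounding every coordinate up to the grid moves a point `t` to at most `ε α + (1 + ε) t`. Since the
means are at least `α`, the additive part `ε α ∑ c` costs at most the fraction `ε` of any
expected cost, so rounding a cover up to the grid loses at most the factor `1 + 2 ε`. The
normalized oracle answers agree with the masses of the grid cells up to the factor `(1 + ε)²`, so
the discrete product measure and the rounded original measure dominate each other up to the factor
`(1 + ε)^(2n)`. The total loss is at most `(1 + ε)^(4n) (1 + 2 ε) ≤ (1 + ε)^(4n + 2)`, and with
`γ' = min γ 1` and `ε = γ' / (60 n)` this is at most `exp (γ' / 10) ≤ (1 - γ' / 10)⁻¹`, which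
leaves room for the factor `1 + γ / 15` within `1 + γ`.

By Bernoulli's inequality the number of grid points is at most of the order of `ε⁻¹` times the
encoding length of `ε α`. All numbers occurring in the computation have polynomial length; for the
partial sums of the oracle answers this holds because the product of all denominators is a common
denominator.
-/

namespace ParetoCover

/-! ## The query coordinates -/

section QueryCoord

variable {ε α : ℚ} {l m : ℕ}

theorem queryCount_le_iff (hε : 0 < ε) (hα : 0 < α) :
    queryCount ε α ≤ m ↔ 1 ≤ ε * α * (1 + ε) ^ m := by
  have hε' : (0 : ℝ) < ε := by exact_mod_cast hε
  have hα' : (0 : ℝ) < α := by exact_mod_cast hα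
  have h : (0 : ℝ) < ε * α := mul_pos hε' hα'
  rw [queryCount, Nat.ceil_le, Real.logb_le_iff_le_rpow (by linarith) (inv_pos.2 h),
    Real.rpow_natCast, inv_le_iff_one_le_mul₀' h]
  exact_mod_cast Iff.rfl

theorem queryCoord_zero (ε α : ℚ) : queryCoord ε α 0 = 0 := rfl

theorem queryCoord_succ_of_lt (h : l < queryCount ε α) :
    queryCoord ε α (l + 1) = ε * α * (1 + ε) ^ l := by
  simp [queryCoord, Nat.succ_le_of_lt h]

theorem queryCoord_of_lt (h : queryCount ε α < l) : queryCoord ε α l = 1 := by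
  rw [queryCoord, if_neg (Nat.ne_zero_of_lt h), if_neg h.not_ge]

theorem queryPrev_zero (ε α : ℚ) : queryPrev ε α 0 = -1 := rfl

theorem queryPrev_succ (ε α : ℚ) (l : ℕ) : queryPrev ε α (l + 1) = queryCoord ε α l := rfl

theorem queryCoord_nonneg (hε : 0 < ε) (hα : 0 < α) (l : ℕ) : 0 ≤ queryCoord ε α l := by
  unfold queryCoord
  split_ifs <;> positivity

theorem queryCoord_lt_succ (hε : 0 < ε) (hα : 0 < α) (h : l ≤ queryCount ε α) :
    queryCoord ε α l < queryCoord ε α (l + 1) := by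
  rcases l with _ | l
  · rw [queryCoord_zero]
    rcases Nat.eq_zero_or_pos (queryCount ε α) with h0 | h0
    · rw [queryCoord_of_lt (by lia)]
      exact one_pos
    · rw [queryCoord_succ_of_lt h0]
      positivity
  · rw [queryCoord_succ_of_lt h]
    rcases h.lt_or_eq with h1 | h1
    · rw [queryCoord_succ_of_lt h1, pow_succ, ← mul_assoc]
      exact lt_mul_of_one_lt_right (by positivity) (by linarith)
    · rw [queryCoord_of_lt (by lia), ← not_le, ← queryCount_le_iff hε hα]
      lia

theorem queryCoord_lt_queryCoord (hε : 0 < ε) (hα : 0 < α) (h : l < m)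
    (hm : m ≤ queryCount ε α + 1) : queryCoord ε α l < queryCoord ε α m := by
  induction m, h using Nat.le_induction with
  | base => exact queryCoord_lt_succ hε hα (by lia)
  | succ m _ ih => exact (ih (by lia)).trans (queryCoord_lt_succ hε hα (by lia))

theorem queryCoord_le_one (hε : 0 < ε) (hα : 0 < α) (l : ℕ) : queryCoord ε α l ≤ 1 := by
  rcases le_or_gt l (queryCount ε α) with h | h
  · rw [← queryCoord_of_lt (Nat.lt_succ_self (queryCount ε α))]
    exact (queryCoord_lt_queryCoord hε hα (Nat.lt_succ_of_le h) le_rfl).le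
  · rw [queryCoord_of_lt h]

theorem queryCoord_succ_le (hε : 0 < ε) (hα : 0 < α) (l : ℕ) :
    queryCoord ε α (l + 1) ≤ ε * α + (1 + ε) * queryCoord ε α l := by
  have hpos : 0 < ε * α := mul_pos hε hα
  have hnonneg := queryCoord_nonneg hε hα l
  rcases lt_or_ge l (queryCount ε α) with hl | hl
  · rw [queryCoord_succ_of_lt hl]
    rcases l with _ | l
    · simp [queryCoord_zero]
    · rw [queryCoord_succ_of_lt (by lia), pow_succ]
      linarith
  · rw [queryCoord_of_lt (Nat.lt_succ_of_le hl)]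
    have h1 := (queryCount_le_iff hε hα).1 hl
    rcases l with _ | l
    · simpa [queryCoord_zero] using h1
    · rcases hl.lt_or_eq with h | h
      · rw [queryCoord_of_lt h]
        linarith
      · rw [queryCoord_succ_of_lt (by lia)]
        rw [pow_succ] at h1
        linarith

theorem queryPrev_lt_queryCoord (hε : 0 < ε) (hα : 0 < α) (h : l ≤ queryCount ε α + 1) :
    queryPrev ε α l < queryCoord ε α l := by
  rcases l with _ | l
  · norm_num [queryPrev_zero, queryCoord_zero]
  · exact queryCoord_lt_succ hε hα (by lia)

theorem validQuery_queryCoord (hε : 0 < ε) (hε1 : ε < 1) (hα : 0 < α)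
    (h : l ≤ queryCount ε α + 1) : ValidQuery (queryPrev ε α l) (queryCoord ε α l) ε := by
  refine ⟨?_, queryPrev_lt_queryCoord hε hα h, queryCoord_le_one hε hα l, hε, hε1⟩
  rcases l with _ | l
  · exact (queryPrev_zero ε α).ge
  · linarith [queryPrev_succ ε α l, queryCoord_nonneg hε hα l]

end QueryCoord

/-! ## The cells of the grid -/

/-- The part of the half-open interval `(a, b]` inside the unit interval: the sets whose masses
the oracles approximate. -/
abbrev cell (a b : ℚ) : Set unitInterval := {x | (a : ℝ) < x ∧ (x : ℝ) ≤ b}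

theorem measureReal_cell (μ : Measure unitInterval) [IsFiniteMeasure μ] {a b : ℚ} (h : a ≤ b) :
    μ.real (cell a b) = μ.real {x | (x : ℝ) ≤ b} - μ.real {x | (x : ℝ) ≤ a} := by
  have hsub : {x : unitInterval | (x : ℝ) ≤ a} ⊆ {x | (x : ℝ) ≤ b} := fun x hx =>
    le_trans (Set.mem_ofPred_eq.le hx) (by exact_mod_cast h)
  rw [← measureReal_sdiff hsub (measurableSet_le measurable_subtype_coe measurable_const)]
  congr 1
  ext x
  simp [and_comm]

theorem sum_measureReal_cell {ε α : ℚ} (hε : 0 < ε) (hα : 0 < α) (μ : Measure unitInterval)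
    [IsProbabilityMeasure μ] :
    ∑ l ∈ Finset.range (queryCount ε α + 2),
      μ.real (cell (queryPrev ε α l) (queryCoord ε α l)) = 1 := by
  set mass : ℚ → ℝ := fun a => μ.real {x | (x : ℝ) ≤ a} with hmass
  have mass_neg_one : mass (-1) = 0 := by
    have : {x : unitInterval | (x : ℝ) ≤ (-1 : ℚ)} = ∅ := by
      ext x
      simpa using by linarith [x.2.1]
    rw [hmass]
    simp only [this, measureReal_empty]
  have mass_one : mass 1 = 1 := by
    have : {x : unitInterval | (x : ℝ) ≤ (1 : ℚ)} = Set.univ := by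
      ext x
      simpa using x.2.2
    simp only [hmass, this, probReal_univ]
  calc ∑ l ∈ Finset.range (queryCount ε α + 2), μ.real (cell (queryPrev ε α l) (queryCoord ε α l))
      = ∑ l ∈ Finset.range (queryCount ε α + 2),
          (mass (queryPrev ε α (l + 1)) - mass (queryPrev ε α l)) :=
        Finset.sum_congr rfl fun l hl => measureReal_cell μ
          (queryPrev_lt_queryCoord hε hα (Nat.le_of_lt_succ (Finset.mem_range.1 hl))).le
    _ = 1 := by
        rw [Finset.sum_range_sub fun l => mass (queryPrev ε α l), queryPrev_zero, queryPrev_succ,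
          queryCoord_of_lt (Nat.lt_succ_self _), mass_one, mass_neg_one, sub_zero]

/-! ## Normalized oracle answers -/

section Normalization

variable {ι : Type*} {s : Finset ι} {i : ι}

section Semiring

variable {R : Type*} [Semiring R] [PartialOrder R] [IsOrderedAddMonoid R] {w m : ι → R} {r : R}

theorem sum_le_of_le_mul (hm : ∑ i ∈ s, m i = 1) (h : ∀ i ∈ s, w i ≤ r * m i) :
    ∑ i ∈ s, w i ≤ r := by
  simpa [← Finset.mul_sum, hm] using Finset.sum_le_sum h

theorem le_sum_of_mul_le (hm : ∑ i ∈ s, m i = 1) (h : ∀ i ∈ s, r * m i ≤ w i) :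
    r ≤ ∑ i ∈ s, w i := by
  simpa [← Finset.mul_sum, hm] using Finset.sum_le_sum h

end Semiring

variable {𝕜 : Type*} [Field 𝕜] [LinearOrder 𝕜] [IsStrictOrderedRing 𝕜] {w m : ι → 𝕜} {r : 𝕜}

theorem div_sum_le (hr : 0 < r) (hm : ∑ i ∈ s, m i = 1) (hlow : ∀ i ∈ s, r⁻¹ * m i ≤ w i)
    (hi : 0 ≤ w i) (hup : w i ≤ r * m i) : w i / ∑ i ∈ s, w i ≤ r ^ 2 * m i := by
  have hsum := le_sum_of_mul_le hm hlow
  calc w i / ∑ i ∈ s, w i ≤ w i / r⁻¹ := by gcongr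
    _ = r * w i := by rw [div_inv_eq_mul, mul_comm]
    _ ≤ r * (r * m i) := by gcongr
    _ = r ^ 2 * m i := by ring

theorem le_mul_div_sum (hr : 0 < r) (hm : ∑ i ∈ s, m i = 1) (hup : ∀ i ∈ s, w i ≤ r * m i)
    (hsum : 0 < ∑ i ∈ s, w i) (hi : 0 ≤ w i) (hlow : r⁻¹ * m i ≤ w i) :
    m i ≤ r ^ 2 * (w i / ∑ i ∈ s, w i) := by
  have hsum_le := sum_le_of_le_mul hm hup
  calc m i ≤ r * w i := (inv_mul_le_iff₀ hr).1 hlow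
    _ = r ^ 2 * (w i / r) := by field_simp
    _ ≤ r ^ 2 * (w i / ∑ i ∈ s, w i) := by gcongr

end Normalization

section Weights

/-- The normalized oracle answers: the probabilities of the reduced instance. -/
noncomputable def queryProb (σ : Oracle) (ε α : ℚ) (l : ℕ) : ℚ :=
  queryWeight σ ε α l / ∑ t ∈ Finset.range (queryCount ε α + 2), queryWeight σ ε α t

variable {σ : Oracle} {μ : Measure unitInterval} {ε α : ℚ} {l : ℕ}

theorem Oracle.Approximates.queryWeight_bounds (h : σ.Approximates μ) (hε : 0 < ε) (hε1 : ε < 1)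
    (hα : 0 < α) (hl : l ∈ Finset.range (queryCount ε α + 2)) :
    0 ≤ queryWeight σ ε α l ∧
      (1 + (ε : ℝ))⁻¹ * μ.real (cell (queryPrev ε α l) (queryCoord ε α l)) ≤
        queryWeight σ ε α l ∧
      (queryWeight σ ε α l : ℝ) ≤
        (1 + (ε : ℝ)) * μ.real (cell (queryPrev ε α l) (queryCoord ε α l)) :=
  h _ _ _ (validQuery_queryCoord hε hε1 hα (Nat.le_of_lt_succ (Finset.mem_range.1 hl)))

theorem Oracle.Approximates.queryProb_mem_Icc (h : σ.Approximates μ) (hε : 0 < ε) (hε1 : ε < 1)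
    (hα : 0 < α) (hl : l ∈ Finset.range (queryCount ε α + 2)) :
    queryProb σ ε α l ∈ Set.Icc (0 : ℚ) 1 := by
  have hw : ∀ t ∈ Finset.range (queryCount ε α + 2), 0 ≤ queryWeight σ ε α t := fun t ht =>
    (h.queryWeight_bounds hε hε1 hα ht).1
  exact ⟨div_nonneg (hw l hl) (Finset.sum_nonneg hw),
    div_le_one_of_le₀ (Finset.single_le_sum hw hl) (Finset.sum_nonneg hw)⟩

variable [IsProbabilityMeasure μ]

theorem Oracle.Approximates.sum_queryWeight_pos (h : σ.Approximates μ) (hε : 0 < ε)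
    (hε1 : ε < 1) (hα : 0 < α) :
    0 < ∑ l ∈ Finset.range (queryCount ε α + 2), queryWeight σ ε α l := by
  have hε' : (0 : ℝ) < 1 + ε := by exact_mod_cast add_pos one_pos hε
  have := le_sum_of_mul_le (sum_measureReal_cell hε hα μ) fun l hl =>
    (h.queryWeight_bounds hε hε1 hα hl).2.1
  exact_mod_cast (inv_pos.2 hε').trans_le this

theorem Oracle.Approximates.sum_queryWeight_le (h : σ.Approximates μ) (hε : 0 < ε)
    (hε1 : ε < 1) (hα : 0 < α) :
    ∑ l ∈ Finset.range (queryCount ε α + 2), queryWeight σ ε α l ≤ 1 + ε := by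
  have := sum_le_of_le_mul (sum_measureReal_cell hε hα μ) fun l hl =>
    (h.queryWeight_bounds hε hε1 hα hl).2.2
  exact_mod_cast this

theorem Oracle.Approximates.queryProb_le (h : σ.Approximates μ) (hε : 0 < ε) (hε1 : ε < 1)
    (hα : 0 < α) (hl : l ∈ Finset.range (queryCount ε α + 2)) :
    (queryProb σ ε α l : ℝ) ≤
      (1 + (ε : ℝ)) ^ 2 * μ.real (cell (queryPrev ε α l) (queryCoord ε α l)) := by
  have hε' : (0 : ℝ) < 1 + ε := by exact_mod_cast add_pos one_pos hε
  have hw := h.queryWeight_bounds hε hε1 hα hl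
  rw [queryProb, Rat.cast_div, Rat.cast_sum]
  exact div_sum_le hε' (sum_measureReal_cell hε hα μ)
    (fun t ht => (h.queryWeight_bounds hε hε1 hα ht).2.1) (by exact_mod_cast hw.1) hw.2.2

theorem Oracle.Approximates.le_queryProb (h : σ.Approximates μ) (hε : 0 < ε) (hε1 : ε < 1)
    (hα : 0 < α) (hl : l ∈ Finset.range (queryCount ε α + 2)) :
    μ.real (cell (queryPrev ε α l) (queryCoord ε α l)) ≤
      (1 + (ε : ℝ)) ^ 2 * queryProb σ ε α l := by
  have hε' : (0 : ℝ) < 1 + ε := by exact_mod_cast add_pos one_pos hε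
  have hw := h.queryWeight_bounds hε hε1 hα hl
  rw [queryProb, Rat.cast_div, Rat.cast_sum]
  exact le_mul_div_sum hε' (sum_measureReal_cell hε hα μ)
    (fun t ht => (h.queryWeight_bounds hε hε1 hα ht).2.2)
    (by exact_mod_cast h.sum_queryWeight_pos hε hε1 hα) (by exact_mod_cast hw.1) hw.2.1

theorem Oracle.Approximates.sum_queryProb (h : σ.Approximates μ) (hε : 0 < ε) (hε1 : ε < 1)
    (hα : 0 < α) : ∑ l ∈ Finset.range (queryCount ε α + 2), queryProb σ ε α l = 1 := by
  unfold queryProb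
  rw [← Finset.sum_div, div_self (h.sum_queryWeight_pos hε hε1 hα).ne']

end Weights

/-! ## Domination of product measures -/

theorem le_pi_of_forall_pi_le {ι : Type*} [Fintype ι] {X : ι → Type*}
    [∀ i, MeasurableSpace (X i)] {μ : ∀ i, Measure (X i)} {ρ : Measure (∀ i, X i)}
    (h : ∀ s : ∀ i, Set (X i), ρ (Set.univ.pi s) ≤ ∏ i, μ i (s i)) : ρ ≤ Measure.pi μ := by
  have houter : ρ.toOuterMeasure ≤ OuterMeasure.pi fun i => (μ i).toOuterMeasure :=
    OuterMeasure.le_pi.2 fun s _ => h s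
  refine Measure.le_iff.2 fun s _ => ?_
  rw [Measure.pi]
  exact (houter s).trans (le_toMeasure_apply _ (Measure.pi_caratheodory μ) s)

theorem pi_le_pow_smul_pi {ι : Type*} [Fintype ι] {X : ι → Type*} [∀ i, MeasurableSpace (X i)]
    {μ ν : ∀ i, Measure (X i)} [∀ i, SigmaFinite (ν i)] {C : ℝ≥0∞} (hC0 : C ≠ 0) (hC : C ≠ ∞)
    (h : ∀ i, ν i ≤ C • μ i) : Measure.pi ν ≤ C ^ Fintype.card ι • Measure.pi μ := by
  have hbox : (C ^ Fintype.card ι)⁻¹ • Measure.pi ν ≤ Measure.pi μ := by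
    refine le_pi_of_forall_pi_le fun s => ?_
    rw [Measure.smul_apply, smul_eq_mul, Measure.pi_pi,
      ENNReal.inv_mul_le_iff (by positivity) (by finiteness), ← Finset.card_univ,
      Finset.pow_card_mul_prod]
    exact Finset.prod_le_prod' fun i _ => h i (s i)
  intro s
  simpa [ENNReal.inv_mul_le_iff, hC0, hC] using hbox s

theorem map_comp_eq_sum {α β γ : Type*} [MeasurableSpace α] [MeasurableSpace β]
    [MeasurableSpace γ] [Fintype β] [MeasurableSingletonClass β] (μ : Measure α) {f : α → β}
    (g : β → γ) (hf : Measurable f) :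
    μ.map (g ∘ f) = ∑ j, μ (f ⁻¹' {j}) • Measure.dirac (g j) := by
  have hg : Measurable g := measurable_of_countable g
  rw [← Measure.map_map hg hf, Measure.map_eq_sum μ f hf, Measure.sum_fintype,
    Measure.map_finset_sum' hg.aemeasurable]
  simp only [Measure.map_smul, Measure.map_dirac' hg]

/-! ## Rounding up to the grid -/

namespace DiscreteInstance

variable {n : ℕ} (J : DiscreteInstance n)

/-- The grid points, as points of the unit interval. -/
def gridPoint (j : Fin (J.M + 2)) : unitInterval := ⟨(J.a j : ℝ), J.a_mem j⟩

theorem gridPoint_strictMono : StrictMono J.gridPoint := fun _ _ h =>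
  Subtype.mk_lt_mk.2 (by exact_mod_cast J.a_strictMono h)

theorem nonempty_filter_le_gridPoint (x : unitInterval) :
    (Finset.univ.filter fun j => x ≤ J.gridPoint j).Nonempty := by
  refine ⟨Fin.last (J.M + 1), Finset.mem_filter.2 ⟨Finset.mem_univ _, Subtype.coe_le_coe.1 ?_⟩⟩
  simpa [gridPoint, J.a_last] using x.2.2

/-- The index of the least grid point above `x`. -/
noncomputable def roundIndex (x : unitInterval) : Fin (J.M + 2) :=
  (Finset.univ.filter fun j => x ≤ J.gridPoint j).min' (J.nonempty_filter_le_gridPoint x)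

theorem gc_roundIndex_gridPoint : GaloisConnection J.roundIndex J.gridPoint := fun x j =>
  ⟨fun h => (Finset.mem_filter.1 (Finset.min'_mem _ (J.nonempty_filter_le_gridPoint x))).2.trans
    (J.gridPoint_strictMono.monotone h),
   fun h => Finset.min'_le _ j (Finset.mem_filter.2 ⟨Finset.mem_univ j, h⟩)⟩

/-- The least grid point above `x`. -/
noncomputable def roundUp : unitInterval → unitInterval := J.gridPoint ∘ J.roundIndex

theorem le_roundUp (x : unitInterval) : x ≤ J.roundUp x := J.gc_roundIndex_gridPoint.le_u_l x

theorem roundUp_mono : Monotone J.roundUp :=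
  J.gc_roundIndex_gridPoint.monotone_u.comp J.gc_roundIndex_gridPoint.monotone_l

theorem measurable_roundUp : Measurable J.roundUp := J.roundUp_mono.measurable

theorem map_roundUp (μ : Measure unitInterval) :
    μ.map J.roundUp = ∑ j, μ (J.roundIndex ⁻¹' {j}) • Measure.dirac (J.gridPoint j) :=
  map_comp_eq_sum μ _ J.gc_roundIndex_gridPoint.monotone_l.measurable

theorem marginal_eq_sum (i : Fin n) :
    J.marginal i = ∑ j, ENNReal.ofReal (J.p i j) • Measure.dirac (J.gridPoint j) := rfl

instance (i : Fin n) : IsProbabilityMeasure (J.marginal i) := ⟨by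
  have hsum : ∑ j, (J.p i j : ℝ) = 1 := by exact_mod_cast J.p_sum i
  simp only [marginal_eq_sum, Measure.finsetSum_apply, Measure.smul_apply, measure_univ,
    smul_eq_mul, mul_one]
  rw [← ENNReal.ofReal_sum_of_nonneg fun j _ => by exact_mod_cast (J.p_mem i j).1, hsum,
    ENNReal.ofReal_one]⟩

instance : IsProbabilityMeasure J.measure := by
  unfold measure
  infer_instance

theorem marginal_le_smul_map_roundUp {μ : Measure unitInterval} {i : Fin n} {C : ℝ≥0∞}
    (h : ∀ j, ENNReal.ofReal (J.p i j) ≤ C * μ (J.roundIndex ⁻¹' {j})) :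
    J.marginal i ≤ C • μ.map J.roundUp := by
  simp only [marginal_eq_sum, map_roundUp, Finset.smul_sum, smul_smul]
  gcongr with j
  exact h j

theorem map_roundUp_le_smul_marginal {μ : Measure unitInterval} {i : Fin n} {C : ℝ≥0∞}
    (h : ∀ j, μ (J.roundIndex ⁻¹' {j}) ≤ C * ENNReal.ofReal (J.p i j)) :
    μ.map J.roundUp ≤ C • J.marginal i := by
  simp only [marginal_eq_sum, map_roundUp, Finset.smul_sum, smul_smul]
  gcongr with j
  exact h j

end DiscreteInstance

/-! ## Covers and their costs -/

section Covers

variable {n : ℕ} {c : Fin n → ℚ} {B B' : Finset (Fin n → unitInterval)}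
  {x b : Fin n → unitInterval}

theorem coverCost_le (hb : b ∈ B) (hx : x ≤ b) :
    coverCost c B x ≤ ENNReal.ofReal (∑ i, (c i : ℝ) * (b i : ℝ)) :=
  (iInf₂_le b hb).trans (iInf_le _ hx)

theorem coverCost_anti (h : B ⊆ B') (x : Fin n → unitInterval) :
    coverCost c B' x ≤ coverCost c B x :=
  le_iInf₂ fun _ hb => le_iInf fun hx => coverCost_le (h hb) hx

theorem coverCost_mono (c : Fin n → ℚ) (B : Finset (Fin n → unitInterval)) :
    Monotone (coverCost c B) := fun _ _ h =>
  le_iInf₂ fun _ hb => le_iInf fun hx => coverCost_le hb (h.trans hx)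

theorem measurable_coverCost (c : Fin n → ℚ) (B : Finset (Fin n → unitInterval)) :
    Measurable (coverCost c B) := by
  classical
  have : coverCost c B = fun x => ⨅ b ∈ B,
      if x ≤ b then ENNReal.ofReal (∑ i, (c i : ℝ) * (b i : ℝ)) else ∞ := by
    funext x
    simp only [coverCost, iInf_eq_if]
  rw [this]
  exact Measurable.biInf _ B.countable_toSet fun b _ =>
    Measurable.ite measurableSet_Iic measurable_const measurable_const

theorem le_coverCost (hc : ∀ i, 0 ≤ c i) (B : Finset (Fin n → unitInterval))
    (x : Fin n → unitInterval) :
    ENNReal.ofReal (∑ i, (c i : ℝ) * (x i : ℝ)) ≤ coverCost c B x := by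
  refine le_iInf₂ fun b _ => le_iInf fun hx => ENNReal.ofReal_le_ofReal ?_
  gcongr with i
  · exact_mod_cast hc i
  · exact hx i

theorem le_expectedCost_pi (hc : ∀ i, 0 ≤ c i) {μ : Fin n → Measure unitInterval}
    [∀ i, IsProbabilityMeasure (μ i)] {a : ℝ} (ha : ∀ i, a ≤ ∫ x, (x : ℝ) ∂(μ i))
    (B : Finset (Fin n → unitInterval)) :
    ENNReal.ofReal (a * ∑ i, (c i : ℝ)) ≤ expectedCost (Measure.pi μ) c B := by
  have hc' : ∀ i, (0 : ℝ) ≤ c i := fun i => by exact_mod_cast hc i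
  have hint : ∀ i, Integrable (fun x : Fin n → unitInterval => (c i : ℝ) * (x i : ℝ))
      (Measure.pi μ) := fun i => by
    refine (Integrable.of_mem_Icc 0 1 ?_ (ae_of_all _ fun x => (x i).2)).const_mul _
    exact (measurable_subtype_coe.comp (measurable_pi_apply i)).aemeasurable
  have hexp : a * ∑ i, (c i : ℝ) ≤ ∫ x, ∑ i, (c i : ℝ) * (x i : ℝ) ∂Measure.pi μ := by
    rw [integral_finsetSum _ fun i _ => hint i, mul_comm, Finset.sum_mul]
    gcongr with i
    have heval : ∫ x : Fin n → unitInterval, (x i : ℝ) ∂Measure.pi μ = ∫ t, (t : ℝ) ∂μ i :=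
      integral_comp_eval measurable_subtype_coe.aestronglyMeasurable
    rw [integral_const_mul, heval]
    exact mul_le_mul_of_nonneg_left (ha i) (hc' i)
  calc ENNReal.ofReal (a * ∑ i, (c i : ℝ))
      ≤ ENNReal.ofReal (∫ x, ∑ i, (c i : ℝ) * (x i : ℝ) ∂Measure.pi μ) :=
        ENNReal.ofReal_le_ofReal hexp
    _ = ∫⁻ x, ENNReal.ofReal (∑ i, (c i : ℝ) * (x i : ℝ)) ∂Measure.pi μ :=
        ofReal_integral_eq_lintegral_ofReal (integrable_finsetSum _ fun i _ => hint i)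
          (ae_of_all _ fun x => Finset.sum_nonneg fun i _ => mul_nonneg (hc' i) (x i).2.1)
    _ ≤ expectedCost (Measure.pi μ) c B := lintegral_mono (le_coverCost hc B)

theorem measurableSet_covered (B : Finset (Fin n → unitInterval)) :
    MeasurableSet {x | ∃ b ∈ B, x ≤ b} := by
  have : {x | ∃ b ∈ B, x ≤ b} = ⋃ b ∈ B, Set.Iic b := by
    ext x
    simp
  rw [this]
  exact B.measurableSet_biUnion fun b _ => measurableSet_Iic

theorem isParetoCover_iff_ae {μ : Measure (Fin n → unitInterval)} [IsProbabilityMeasure μ] :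
    IsParetoCover μ B ↔ ∀ᵐ x ∂μ, ∃ b ∈ B, x ≤ b :=
  (mem_ae_iff_prob_eq_one (measurableSet_covered B)).symm

theorem IsParetoCover.exists_isSolution_superset (hn : 1 ≤ n)
    {μ : Measure (Fin n → unitInterval)} [IsProbabilityMeasure μ] {k : ℕ}
    (hB : IsParetoCover μ B) (hk : B.card ≤ k) : ∃ B', B ⊆ B' ∧ IsSolution μ k B' := by
  have : Nonempty (Fin n) := ⟨⟨0, hn⟩⟩
  have : Infinite unitInterval := (Set.Icc_infinite zero_lt_one).to_subtype
  have : Infinite (Fin n → unitInterval) := Pi.infinite_of_right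
  obtain ⟨B', h, hcard⟩ := Infinite.exists_superset_card_eq B k hk
  rw [isParetoCover_iff_ae] at hB
  exact ⟨B', h, hcard, isParetoCover_iff_ae.2 (hB.mono fun x ⟨b, hb, hx⟩ => ⟨b, h hb, hx⟩)⟩

end Covers

/-! ## Transfer of solutions along a rounding map -/

/-- `f` rounds the points of the cube up, in a measurable and monotone way, and increases a
coordinate `t` at most to `s + r * t`. -/
structure IsRounding {n : ℕ} (f : (Fin n → unitInterval) → Fin n → unitInterval) (s r : ℝ) :
    Prop where
  measurable : Measurable f
  monotone : Monotone f
  le_apply : ∀ x, x ≤ f x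
  apply_le : ∀ x i, (f x i : ℝ) ≤ s + r * x i

namespace IsRounding

variable {n : ℕ} {f : (Fin n → unitInterval) → Fin n → unitInterval} {s r K δ : ℝ}
  {c : Fin n → ℚ} {B : Finset (Fin n → unitInterval)} {k : ℕ}

theorem coverCost_image_le [DecidableEq (Fin n → unitInterval)] (hf : IsRounding f s r)
    (hr : 0 < r) (hc : ∀ i, 0 ≤ c i) (x : Fin n → unitInterval) :
    coverCost c (B.image f) (f x) ≤
      ENNReal.ofReal (s * ∑ i, (c i : ℝ)) + ENNReal.ofReal r * coverCost c B x := by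
  simp only [coverCost, ENNReal.mul_iInf_of_ne (ENNReal.ofReal_pos.2 hr).ne' ENNReal.ofReal_ne_top,
    ENNReal.add_iInf]
  refine le_iInf₂ fun b hb => le_iInf fun hx => ?_
  calc coverCost c (B.image f) (f x)
      ≤ ENNReal.ofReal (∑ i, (c i : ℝ) * (f b i : ℝ)) :=
        coverCost_le (Finset.mem_image_of_mem f hb) (hf.monotone hx)
    _ ≤ ENNReal.ofReal (s * ∑ i, (c i : ℝ) + r * ∑ i, (c i : ℝ) * (b i : ℝ)) := by
        refine ENNReal.ofReal_le_ofReal ?_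
        rw [Finset.mul_sum, Finset.mul_sum, ← Finset.sum_add_distrib]
        refine Finset.sum_le_sum fun i _ => ?_
        have hci : (0 : ℝ) ≤ c i := by exact_mod_cast hc i
        linarith [mul_le_mul_of_nonneg_left (hf.apply_le b i) hci]
    _ ≤ _ := by
        rw [← ENNReal.ofReal_mul hr.le]
        exact ENNReal.ofReal_add_le

variable {μ ν : Measure (Fin n → unitInterval)}

theorem expectedCost_le (hf : IsRounding f s r) (h : μ.map f ≤ ENNReal.ofReal K • ν) :
    expectedCost μ c B ≤ ENNReal.ofReal K * expectedCost ν c B := by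
  calc expectedCost μ c B ≤ ∫⁻ x, coverCost c B (f x) ∂μ :=
        lintegral_mono fun x => coverCost_mono c B (hf.le_apply x)
    _ = ∫⁻ x, coverCost c B x ∂(μ.map f) :=
        (lintegral_map (measurable_coverCost c B) hf.measurable).symm
    _ ≤ ∫⁻ x, coverCost c B x ∂(ENNReal.ofReal K • ν) := lintegral_mono' h le_rfl
    _ = ENNReal.ofReal K * expectedCost ν c B := by rw [lintegral_smul_measure]; rfl

variable [IsProbabilityMeasure μ] [IsProbabilityMeasure ν]

theorem isSolution_of_map_absolutelyContinuous (hf : IsRounding f s r) (h : μ.map f ≪ ν)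
    (hB : IsSolution ν k B) : IsSolution μ k B := by
  have hcover := (isParetoCover_iff_ae.1 hB.2).filter_mono h.ae_le
  rw [ae_map_iff hf.measurable.aemeasurable (measurableSet_covered B)] at hcover
  exact ⟨hB.1, isParetoCover_iff_ae.2 (hcover.mono fun x ⟨b, hb, hx⟩ =>
    ⟨b, hb, (hf.le_apply x).trans hx⟩)⟩

theorem isParetoCover_image [DecidableEq (Fin n → unitInterval)] (hf : IsRounding f s r)
    (h : ν ≪ μ.map f) (hB : IsParetoCover μ B) : IsParetoCover ν (B.image f) := by
  refine isParetoCover_iff_ae.2 (h.ae_le ?_)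
  rw [isParetoCover_iff_ae] at hB
  exact (ae_map_iff hf.measurable.aemeasurable (measurableSet_covered _)).2
    (hB.mono fun x ⟨b, hb, hx⟩ => ⟨f b, Finset.mem_image_of_mem f hb, hf.monotone hx⟩)

theorem optCost_le_expectedCost (hf : IsRounding f s r) (hn : 1 ≤ n) (hr : 0 < r)
    (hc : ∀ i, 0 ≤ c i) (h : ν ≤ ENNReal.ofReal K • μ.map f) (hB : IsSolution μ k B) :
    optCost ν c k ≤ ENNReal.ofReal K *
      (ENNReal.ofReal (s * ∑ i, (c i : ℝ)) + ENNReal.ofReal r * expectedCost μ c B) := by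
  classical
  obtain ⟨B', hB', hsol⟩ := (hf.isParetoCover_image
    (Measure.absolutelyContinuous_of_le_smul h) hB.2).exists_isSolution_superset hn
    (Finset.card_image_le.trans hB.1.le)
  calc optCost ν c k ≤ expectedCost ν c B' := iInf₂_le B' hsol
    _ ≤ ∫⁻ x, coverCost c (B.image f) x ∂(ENNReal.ofReal K • μ.map f) :=
        lintegral_mono' h fun x => coverCost_anti hB' x
    _ = ENNReal.ofReal K * ∫⁻ x, coverCost c (B.image f) (f x) ∂μ := by
        rw [lintegral_smul_measure, lintegral_map (measurable_coverCost c _) hf.measurable,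
          smul_eq_mul]
    _ ≤ ENNReal.ofReal K * ∫⁻ x, (ENNReal.ofReal (s * ∑ i, (c i : ℝ)) +
          ENNReal.ofReal r * coverCost c B x) ∂μ := by
        gcongr with x
        exact hf.coverCost_image_le hr hc x
    _ = _ := by
        rw [lintegral_add_left measurable_const, lintegral_const, measure_univ, mul_one,
          lintegral_const_mul _ (measurable_coverCost c B)]
        rfl

theorem optCost_le (hf : IsRounding f s r) (hn : 1 ≤ n) (hr : 0 < r) (hδ : 0 ≤ δ) (hK : 0 < K)
    (hc : ∀ i, 0 ≤ c i) (h : ν ≤ ENNReal.ofReal K • μ.map f)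
    (hlow : ∀ B, ENNReal.ofReal (s * ∑ i, (c i : ℝ)) ≤ ENNReal.ofReal δ * expectedCost μ c B) :
    optCost ν c k ≤ ENNReal.ofReal (K * (δ + r)) * optCost μ c k := by
  have hpos : 0 < K * (δ + r) := by positivity
  simp only [optCost.eq_1 μ,
    ENNReal.mul_iInf_of_ne (ENNReal.ofReal_pos.2 hpos).ne' ENNReal.ofReal_ne_top]
  refine le_iInf₂ fun B hB => (hf.optCost_le_expectedCost hn hr hc h hB).trans ?_
  rw [ENNReal.ofReal_mul hK.le, ENNReal.ofReal_add hδ hr.le, mul_assoc, add_mul]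
  gcongr
  exact hlow B

theorem isApproxSolution (hf : IsRounding f s r) (hn : 1 ≤ n) (hr : 0 < r) (hδ : 0 ≤ δ)
    (hK : 0 < K) (hc : ∀ i, 0 ≤ c i) (hμν : μ.map f ≤ ENNReal.ofReal K • ν)
    (hνμ : ν ≤ ENNReal.ofReal K • μ.map f)
    (hlow : ∀ B, ENNReal.ofReal (s * ∑ i, (c i : ℝ)) ≤ ENNReal.ofReal δ * expectedCost μ c B)
    {q : ℝ} (hq : 0 ≤ q) (hB : IsApproxSolution ν c k q B) :
    IsApproxSolution μ c k (K * q * (K * (δ + r))) B := by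
  refine ⟨hf.isSolution_of_map_absolutelyContinuous
    (Measure.absolutelyContinuous_of_le_smul hμν) hB.1, ?_⟩
  calc expectedCost μ c B ≤ ENNReal.ofReal K * expectedCost ν c B := hf.expectedCost_le hμν
    _ ≤ ENNReal.ofReal K * (ENNReal.ofReal q *
          (ENNReal.ofReal (K * (δ + r)) * optCost μ c k)) := by
        gcongr
        exact hB.2.trans (by gcongr; exact hf.optCost_le hn hr hδ hK hc hνμ hlow)
    _ = ENNReal.ofReal (K * q * (K * (δ + r))) * optCost μ c k := by
        simp only [mul_assoc, ENNReal.ofReal_mul hK.le, ENNReal.ofReal_mul hq]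

end IsRounding

theorem DiscreteInstance.isRounding_roundUp {n : ℕ} (J : DiscreteInstance n) {s r : ℝ}
    (h : ∀ x : unitInterval, (J.roundUp x : ℝ) ≤ s + r * x) :
    IsRounding (fun (x : Fin n → unitInterval) i => J.roundUp (x i)) s r where
  measurable := measurable_pi_lambda _ fun i => J.measurable_roundUp.comp (measurable_pi_apply i)
  monotone _ _ h i := J.roundUp_mono (h i)
  le_apply x i := J.le_roundUp (x i)
  apply_le x i := h (x i)

/-! ## The reduced instance approximates the original one -/

section Discretize

variable {n : ℕ} (I : Instance n) {ε : ℚ} (hε : 0 < ε) (hε1 : ε < 1)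

/-- The reduced instance for an arbitrary accuracy `ε`: the query coordinates as grid and the
normalized oracle answers as probabilities. -/
noncomputable def Instance.discretize : DiscreteInstance n where
  M := queryCount ε I.α
  a j := queryCoord ε I.α j
  a_strictMono i j h := queryCoord_lt_queryCoord hε I.α_pos h (by lia)
  a_zero := queryCoord_zero _ _
  a_last := queryCoord_of_lt (by simp)
  p i j := queryProb (I.oracle i) ε I.α j
  p_mem i j := (I.nice i).1.queryProb_mem_Icc hε hε1 I.α_pos (Finset.mem_range.2 j.2)
  p_sum i := by
    have := I.isProb i
    rw [Fin.sum_univ_eq_sum_range (fun j => queryProb (I.oracle i) ε I.α j)]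
    exact (I.nice i).1.sum_queryProb hε hε1 I.α_pos
  c := I.c
  c_nonneg := I.c_nonneg
  k := I.k
  one_le_k := I.one_le_k

theorem roundIndex_discretize_preimage (j : Fin ((I.discretize hε hε1).M + 2)) :
    (I.discretize hε hε1).roundIndex ⁻¹' {j} = cell (queryPrev ε I.α j) (queryCoord ε I.α j) := by
  have hle : ∀ (x : unitInterval) (j : Fin ((I.discretize hε hε1).M + 2)),
      (I.discretize hε hε1).roundIndex x ≤ j ↔ (x : ℝ) ≤ queryCoord ε I.α j :=
    (I.discretize hε hε1).gc_roundIndex_gridPoint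
  ext x
  rw [Set.mem_preimage, Set.mem_singleton_iff, le_antisymm_iff, hle, and_comm]
  refine and_congr_left fun _ => ?_
  rcases j with ⟨_ | l, hl⟩
  · refine iff_of_true (Fin.zero_le _) ?_
    rw [queryPrev_zero]
    push_cast
    linarith [x.2.1]
  · rw [queryPrev_succ, ← not_le, ← hle x ⟨l, Nat.lt_of_succ_lt hl⟩, not_le]
    exact Nat.succ_le_iff

theorem roundUp_discretize_le (x : unitInterval) :
    ((I.discretize hε hε1).roundUp x : ℝ) ≤ (ε : ℝ) * I.α + (1 + (ε : ℝ)) * x := by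
  have : (0 : ℝ) < ε := by exact_mod_cast hε
  have hα' : (0 : ℝ) < I.α := by exact_mod_cast I.α_pos
  have hx0 := x.2.1
  set j := (I.discretize hε hε1).roundIndex x with hj
  have hx : x ∈ cell (queryPrev ε I.α j) (queryCoord ε I.α j) := by
    rw [← roundIndex_discretize_preimage I hε hε1 j]
    exact hj.symm
  change ((queryCoord ε I.α j : ℚ) : ℝ) ≤ _
  rcases h : (j : ℕ) with _ | l
  · rw [queryCoord_zero]
    push_cast
    positivity
  · rw [h, queryPrev_succ] at hx
    calc ((queryCoord ε I.α (l + 1) : ℚ) : ℝ)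
        ≤ ε * I.α + (1 + ε) * queryCoord ε I.α l := by
          exact_mod_cast queryCoord_succ_le hε I.α_pos l
      _ ≤ ε * I.α + (1 + ε) * x := by
          gcongr
          exact hx.1.le

theorem marginal_discretize_le (i : Fin n) :
    (I.discretize hε hε1).marginal i ≤
      ENNReal.ofReal ((1 + (ε : ℝ)) ^ 2) • (I.μ i).map (I.discretize hε hε1).roundUp := by
  have := I.isProb i
  refine DiscreteInstance.marginal_le_smul_map_roundUp _ fun j => ?_
  rw [roundIndex_discretize_preimage, ← ofReal_measureReal, ← ENNReal.ofReal_mul (by positivity)]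
  exact ENNReal.ofReal_le_ofReal
    ((I.nice i).1.queryProb_le hε hε1 I.α_pos (Finset.mem_range.2 j.2))

theorem map_roundUp_discretize_le (i : Fin n) :
    (I.μ i).map (I.discretize hε hε1).roundUp ≤
      ENNReal.ofReal ((1 + (ε : ℝ)) ^ 2) • (I.discretize hε hε1).marginal i := by
  have := I.isProb i
  refine DiscreteInstance.map_roundUp_le_smul_marginal _ fun j => ?_
  rw [roundIndex_discretize_preimage, ← ofReal_measureReal, ← ENNReal.ofReal_mul (by positivity)]
  exact ENNReal.ofReal_le_ofReal
    ((I.nice i).1.le_queryProb hε hε1 I.α_pos (Finset.mem_range.2 j.2))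

theorem IsApproxSolution.of_discretize (hn : 1 ≤ n) {q : ℝ} (hq : 0 ≤ q)
    {B : Finset (Fin n → unitInterval)}
    (hB : IsApproxSolution (I.discretize hε hε1).measure I.c I.k q B) :
    IsApproxSolution I.measure I.c I.k
      (((1 + (ε : ℝ)) ^ 2) ^ n * q * (((1 + (ε : ℝ)) ^ 2) ^ n * (ε + (1 + (ε : ℝ))))) B := by
  have hprob := I.isProb
  have hε' : (0 : ℝ) < ε := by exact_mod_cast hε
  set J := I.discretize hε hε1
  have : ∀ i, IsProbabilityMeasure ((I.μ i).map J.roundUp) := fun i =>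
    Measure.isProbabilityMeasure_map J.measurable_roundUp.aemeasurable
  have : IsProbabilityMeasure I.measure := by unfold Instance.measure; infer_instance
  have hC : ENNReal.ofReal ((1 + (ε : ℝ)) ^ 2) ≠ 0 := (ENNReal.ofReal_pos.2 (by positivity)).ne'
  have hpow : ENNReal.ofReal ((1 + (ε : ℝ)) ^ 2) ^ Fintype.card (Fin n) =
      ENNReal.ofReal (((1 + (ε : ℝ)) ^ 2) ^ n) := by
    rw [Fintype.card_fin, ← ENNReal.ofReal_pow (by positivity)]
  have hmap : I.measure.map (fun x i => J.roundUp (x i)) =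
      Measure.pi fun i => (I.μ i).map J.roundUp :=
    Measure.pi_map_pi fun i => J.measurable_roundUp.aemeasurable
  refine (J.isRounding_roundUp (roundUp_discretize_le I hε hε1)).isApproxSolution hn
    (by positivity) hε'.le (by positivity) I.c_nonneg ?_ ?_ (fun B => ?_) hq hB
  · rw [hmap, ← hpow]
    exact pi_le_pow_smul_pi hC ENNReal.ofReal_ne_top (map_roundUp_discretize_le I hε hε1)
  · rw [hmap, ← hpow]
    exact pi_le_pow_smul_pi hC ENNReal.ofReal_ne_top (marginal_discretize_le I hε hε1)
  · rw [mul_assoc, ENNReal.ofReal_mul hε'.le]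
    gcongr
    exact le_expectedCost_pi I.c_nonneg I.α_le B

end Discretize

/-! ## The accuracy -/

section Accuracy

variable {n : ℕ} {γ : ℚ}

theorem accuracy_pos (hn : 1 ≤ n) (hγ : 0 < γ) : 0 < accuracy n γ :=
  div_pos (lt_min hγ one_pos) (by positivity)

theorem accuracy_mul (hn : 1 ≤ n) (γ : ℚ) : accuracy n γ * (60 * n) = min γ 1 :=
  div_mul_cancel₀ _ (by positivity)

theorem accuracy_lt_one (hn : 1 ≤ n) (γ : ℚ) : accuracy n γ < 1 := by
  have hn' : (1 : ℚ) ≤ n := by exact_mod_cast hn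
  rw [accuracy, div_lt_one (by positivity)]
  linarith [min_le_right γ 1]

theorem pow_mul_le_one_div_one_sub {ε g : ℝ} (hn : 1 ≤ n) (hg0 : 0 ≤ g) (hg1 : g ≤ 1)
    (hε : ε * (60 * n) = g) :
    ((1 + ε) ^ 2) ^ n * ((1 + ε) ^ 2) ^ n * (ε + (1 + ε)) ≤ 1 / (1 - g / 10) := by
  have hn' : (1 : ℝ) ≤ n := by exact_mod_cast hn
  have hε0 : 0 ≤ ε := nonneg_of_mul_nonneg_left (hε.symm ▸ hg0) (by positivity)
  have hlast : ε + (1 + ε) ≤ (1 + ε) ^ 2 := by nlinarith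
  calc ((1 + ε) ^ 2) ^ n * ((1 + ε) ^ 2) ^ n * (ε + (1 + ε))
      ≤ ((1 + ε) ^ 2) ^ n * ((1 + ε) ^ 2) ^ n * (1 + ε) ^ 2 := by gcongr
    _ = (1 + ε) ^ (4 * n + 2) := by
        rw [← pow_mul, ← pow_add, ← pow_add]
        congr 1
        ring
    _ ≤ Real.exp ε ^ (4 * n + 2) := by
        gcongr
        linarith [Real.add_one_le_exp ε]
    _ = Real.exp ((4 * n + 2) * ε) := by
        rw [← Real.exp_nat_mul]
        push_cast
        rfl
    _ ≤ Real.exp (g / 10) := by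
        gcongr
        nlinarith
    _ ≤ 1 / (1 - g / 10) :=
        Real.exp_bound_div_one_sub_of_interval (by positivity) (by linarith)

theorem approximation_factor_le (hn : 1 ≤ n) (hγ : 0 < γ) :
    ((1 + (accuracy n γ : ℝ)) ^ 2) ^ n * (1 + (γ : ℝ) / 15) *
      (((1 + (accuracy n γ : ℝ)) ^ 2) ^ n * (accuracy n γ + (1 + (accuracy n γ : ℝ)))) ≤
        1 + γ := by
  have hγ' : (0 : ℝ) < γ := by exact_mod_cast hγ
  set g : ℝ := min γ 1 with hg
  have hg0 : 0 < g := lt_min hγ' one_pos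
  have hgγ : g ≤ γ := min_le_left _ _
  have hg1 : g ≤ 1 := min_le_right _ _
  have hε : (accuracy n γ : ℝ) * (60 * n) = g := by
    rw [hg]
    exact_mod_cast accuracy_mul hn γ
  calc ((1 + (accuracy n γ : ℝ)) ^ 2) ^ n * (1 + (γ : ℝ) / 15) *
        (((1 + (accuracy n γ : ℝ)) ^ 2) ^ n * (accuracy n γ + (1 + (accuracy n γ : ℝ))))
      = ((1 + (accuracy n γ : ℝ)) ^ 2) ^ n * ((1 + (accuracy n γ : ℝ)) ^ 2) ^ n *
          (accuracy n γ + (1 + (accuracy n γ : ℝ))) * (1 + (γ : ℝ) / 15) := by ring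
    _ ≤ 1 / (1 - g / 10) * (1 + (γ : ℝ) / 15) := by
        gcongr
        exact pow_mul_le_one_div_one_sub hn hg0.le hg1 hε
    _ ≤ 1 + γ := by
        rw [one_div_mul_eq_div, div_le_iff₀ (by linarith)]
        nlinarith [mul_le_mul_of_nonneg_left hg1 hγ'.le]

theorem IsApproxSolution.mono {μ : Measure (Fin n → unitInterval)} {c : Fin n → ℚ} {k : ℕ}
    {q r : ℝ} {B : Finset (Fin n → unitInterval)} (hqr : q ≤ r)
    (hB : IsApproxSolution μ c k q B) : IsApproxSolution μ c k r B :=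
  ⟨hB.1, hB.2.trans (by gcongr)⟩

/-- The reduced instance `I_γ`. -/
noncomputable abbrev Instance.reduced (I : Instance n) (hn : 1 ≤ n) (hγ : 0 < γ) :
    DiscreteInstance n :=
  I.discretize (accuracy_pos hn hγ) (accuracy_lt_one hn γ)

theorem Instance.isReducedInstance_reduced (I : Instance n) (hn : 1 ≤ n) (hγ : 0 < γ) :
    IsReducedInstance I γ (I.reduced hn hγ) :=
  ⟨rfl, rfl, rfl, fun _ => rfl, fun _ _ => rfl⟩

theorem IsApproxSolution.of_reduced (I : Instance n) (hn : 1 ≤ n) (hγ : 0 < γ)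
    {B : Finset (Fin n → unitInterval)}
    (hB : IsApproxSolution (I.reduced hn hγ).measure I.c I.k (1 + (γ : ℝ) / 15) B) :
    IsApproxSolution I.measure I.c I.k (1 + (γ : ℝ)) B := by
  have : (0 : ℝ) < γ := by exact_mod_cast hγ
  exact (hB.of_discretize I _ _ hn (by positivity)).mono (approximation_factor_le hn hγ)

end Accuracy

/-! ## Encoding lengths -/

theorem size_mul_le (a b : ℕ) : Nat.size (a * b) ≤ Nat.size a + Nat.size b := by
  rw [Nat.size_le, pow_add]
  exact Nat.mul_lt_mul'' (Nat.lt_size_self a) (Nat.lt_size_self b)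

theorem size_add_le (a b : ℕ) : Nat.size (a + b) ≤ Nat.size a + Nat.size b + 1 := by
  rw [Nat.size_le, pow_succ, pow_add]
  nlinarith [Nat.lt_size_self a, Nat.lt_size_self b, Nat.one_le_two_pow (n := Nat.size a),
    Nat.one_le_two_pow (n := Nat.size b)]

theorem size_le_self (n : ℕ) : Nat.size n ≤ n := Nat.size_le.2 Nat.lt_two_pow_self

theorem size_den_lt_ratSize (x : ℚ) : Nat.size x.den < ratSize x := by
  unfold ratSize
  lia

theorem one_le_ratSize (x : ℚ) : 1 ≤ ratSize x := Nat.one_le_of_lt (size_den_lt_ratSize x)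

theorem ratSize_natCast (n : ℕ) : ratSize n = Nat.size n + 2 := by
  simp only [ratSize, Rat.num_natCast, Int.natAbs_natCast, Rat.den_natCast, Nat.size_one]
  lia

theorem ratSize_natCast_le (n : ℕ) : ratSize n ≤ n + 2 := by
  rw [ratSize_natCast]
  gcongr
  exact size_le_self n

theorem ratSize_natCast_mono {m n : ℕ} (h : m ≤ n) : ratSize m ≤ ratSize n := by
  rw [ratSize_natCast, ratSize_natCast]
  gcongr
  exact Nat.size_le_size h

theorem ratSize_neg (x : ℚ) : ratSize (-x) = ratSize x := by
  rw [ratSize, ratSize, Rat.neg_num, Rat.neg_den, Int.natAbs_neg]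

theorem ratSize_inv (x : ℚ) : ratSize x⁻¹ = ratSize x := by
  rcases eq_or_ne x 0 with rfl | hx
  · rw [inv_zero]
  · have hn : x.num ≠ 0 := Rat.num_ne_zero.2 hx
    simp only [ratSize, Rat.num_inv, Rat.den_inv, hn, if_false, Int.natAbs_mul,
      Int.natAbs_natCast, Int.natAbs_sign_of_ne_zero hn, one_mul]
    lia

theorem ratSize_divInt_le (a : ℤ) {b : ℕ} (hb : b ≠ 0) :
    ratSize (Rat.divInt a b) ≤ 1 + Nat.size a.natAbs + Nat.size b := by
  have hnum : Nat.size (Rat.divInt a b).num.natAbs ≤ Nat.size a.natAbs := by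
    rcases eq_or_ne a 0 with rfl | ha
    · rw [Rat.zero_divInt, Rat.num_zero]
    · exact Nat.size_le_size (Nat.le_of_dvd (Int.natAbs_pos.2 ha)
        (Int.natAbs_dvd_natAbs.2 (Rat.num_dvd a (by exact_mod_cast hb))))
  have hden : Nat.size (Rat.divInt a b).den ≤ Nat.size b :=
    Nat.size_le_size (Nat.le_of_dvd (Nat.pos_of_ne_zero hb) (by exact_mod_cast Rat.den_dvd a b))
  unfold ratSize
  gcongr

theorem ratSize_mul_le (x y : ℚ) : ratSize (x * y) ≤ ratSize x + ratSize y := by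
  have hxy : x * y = Rat.divInt (x.num * y.num) ((x.den * y.den : ℕ) : ℤ) := by
    rw [Rat.divInt_eq_div]
    push_cast
    rw [← div_mul_div_comm, Rat.num_div_den, Rat.num_div_den]
  have hnum := size_mul_le x.num.natAbs y.num.natAbs
  have hden := size_mul_le x.den y.den
  calc ratSize (x * y) ≤ 1 + Nat.size (x.num * y.num).natAbs + Nat.size (x.den * y.den) :=
        hxy ▸ ratSize_divInt_le _ (mul_ne_zero x.den_nz y.den_nz)
    _ ≤ ratSize x + ratSize y := by
        rw [Int.natAbs_mul]
        unfold ratSize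
        lia

theorem ratSize_div_le (x y : ℚ) : ratSize (x / y) ≤ ratSize x + ratSize y := by
  rw [div_eq_mul_inv, ← ratSize_inv y]
  exact ratSize_mul_le _ _

theorem ratSize_add_le (x y : ℚ) : ratSize (x + y) ≤ 2 * (ratSize x + ratSize y) := by
  have hnum : Nat.size (x.num * y.den + x.den * y.num).natAbs ≤
      Nat.size (x.num.natAbs * y.den + x.den * y.num.natAbs) := by
    refine Nat.size_le_size ((Int.natAbs_add_le _ _).trans_eq ?_)
    simp only [Int.natAbs_mul, Int.natAbs_natCast]
  have hadd := size_add_le (x.num.natAbs * y.den) (x.den * y.num.natAbs)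
  have hx := size_mul_le x.num.natAbs y.den
  have hy := size_mul_le x.den y.num.natAbs
  have hden := size_mul_le x.den y.den
  rw [Rat.add_num_den]
  refine (ratSize_divInt_le _ (mul_ne_zero x.den_nz y.den_nz)).trans ?_
  unfold ratSize
  lia

theorem ratSize_sub_le (x y : ℚ) : ratSize (x - y) ≤ 2 * (ratSize x + ratSize y) := by
  rw [sub_eq_add_neg, ← ratSize_neg y]
  exact ratSize_add_le _ _

theorem ratSize_floor_le (x : ℚ) : ratSize (⌊x⌋ : ℚ) ≤ ratSize x := by
  have hnum : ⌊x⌋.natAbs ≤ x.num.natAbs := by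
    rw [Rat.floor_def']
    exact Int.natAbs_ediv_le_natAbs _ _
  simp only [ratSize, Rat.num_intCast, Rat.den_intCast]
  gcongr ?_ + ?_
  · gcongr
    exact Nat.size_le_size hnum
  · exact Nat.size_le_size x.pos

theorem ratSize_pow_le (x : ℚ) (m : ℕ) : ratSize (x ^ m) ≤ m * ratSize x + 3 := by
  induction m with
  | zero => rw [pow_zero, ← Nat.cast_one, ratSize_natCast, Nat.size_one, zero_mul]
  | succ m ih =>
    rw [pow_succ, Nat.succ_mul]
    exact (ratSize_mul_le _ _).trans (by lia)

theorem ratSize_le_of_le_natCast {x : ℚ} {k : ℕ} (h0 : 0 ≤ x) (hk : x ≤ k) :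
    ratSize x ≤ 2 * Nat.size x.den + Nat.size k + 1 := by
  have hnum : x.num.natAbs ≤ k * x.den := by
    have hle : (x.num : ℚ) ≤ k * x.den := by
      rwa [← div_le_iff₀ (by exact_mod_cast x.pos), Rat.num_div_den]
    have hle' : x.num ≤ k * x.den := by exact_mod_cast hle
    rwa [← Int.natAbs_of_nonneg (Rat.num_nonneg.2 h0), ← Nat.cast_mul, Nat.cast_le] at hle'
  have hsize := (Nat.size_le_size hnum).trans (size_mul_le k x.den)
  unfold ratSize
  lia

theorem size_den_sum_le {ι : Type*} (s : Finset ι) (f : ι → ℚ) :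
    Nat.size (∑ i ∈ s, f i).den ≤ ∑ i ∈ s, ratSize (f i) + 1 := by
  classical
  induction s using Finset.induction_on with
  | empty => rw [Finset.sum_empty, Finset.sum_empty, Rat.den_zero, Nat.size_one]
  | insert i s hi ih =>
    rw [Finset.sum_insert hi, Finset.sum_insert hi]
    calc Nat.size (f i + ∑ j ∈ s, f j).den
        ≤ Nat.size ((f i).den * (∑ j ∈ s, f j).den) :=
          Nat.size_le_size (Nat.le_of_dvd (Nat.mul_pos (f i).pos (∑ j ∈ s, f j).pos)
            (Rat.add_den_dvd _ _))
      _ ≤ Nat.size (f i).den + Nat.size (∑ j ∈ s, f j).den := size_mul_le _ _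
      _ ≤ ratSize (f i) + ∑ j ∈ s, ratSize (f j) + 1 := by
          have hi := size_den_lt_ratSize (f i)
          lia

/-! ## Cost bounds for expressions and programs -/

/-- All memory entries have encoding length at most `b`. -/
def Store.Bounded (s : Store) (b : ℕ) : Prop := ∀ A l, ratSize (s A l) ≤ b

namespace Store

variable {s : Store} {A A' l l' b : ℕ} {q : ℚ}

theorem set_self (s : Store) (A l : ℕ) (q : ℚ) : s.set A l q A l = q := by
  rw [set, Function.update_self, Function.update_self]

theorem set_of_ne (h : A' ≠ A) : s.set A l q A' = s A' :=
  Function.update_of_ne h _ _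

theorem set_entry_of_ne (h : l' ≠ l) : s.set A l q A l' = s A l' := by
  rw [set, Function.update_self, Function.update_of_ne h]

theorem Bounded.set (hs : s.Bounded b) (hq : ratSize q ≤ b) : (s.set A l q).Bounded b := by
  intro A' l'
  rcases eq_or_ne A' A with rfl | hA
  · rcases eq_or_ne l' l with rfl | hl
    · rwa [set_self]
    · rw [set_entry_of_ne hl]
      exact hs _ _
  · rw [set_of_ne hA]
    exact hs _ _

theorem Bounded.pos (hs : s.Bounded b) : 0 < b := (one_le_ratSize _).trans (hs 0 0)

end Store

namespace Expr

/-- The encoding length of the value, in multiples of a bound for the memory. -/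
def valWeight : Expr → ℕ
  | .lit q => ratSize q
  | .read _ _ => 1
  | .add x y => 2 * (x.valWeight + y.valWeight)
  | .sub x y => 2 * (x.valWeight + y.valWeight)
  | .mul x y => x.valWeight + y.valWeight
  | .div x y => x.valWeight + y.valWeight
  | .floor x => x.valWeight

/-- The bit cost, in multiples of a bound for the memory. -/
def costWeight : Expr → ℕ
  | .lit q => ratSize q
  | .read _ e => e.costWeight + 1
  | .add x y => x.costWeight + y.costWeight + 2 * (x.valWeight + y.valWeight)
  | .sub x y => x.costWeight + y.costWeight + 2 * (x.valWeight + y.valWeight)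
  | .mul x y => x.costWeight + y.costWeight + (x.valWeight + y.valWeight)
  | .div x y => x.costWeight + y.costWeight + (x.valWeight + y.valWeight)
  | .floor x => x.costWeight + x.valWeight

variable {s : Store} {b : ℕ}

theorem ratSize_val_le (hs : s.Bounded b) (e : Expr) : ratSize (e.val s) ≤ e.valWeight * b := by
  induction e with
  | lit q => exact Nat.le_mul_of_pos_right _ hs.pos
  | read A e _ => exact (hs A _).trans_eq (one_mul b).symm
  | add x y hx hy =>
    refine (ratSize_add_le _ _).trans ?_
    rw [valWeight, mul_assoc, add_mul]
    gcongr
  | sub x y hx hy =>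
    refine (ratSize_sub_le _ _).trans ?_
    rw [valWeight, mul_assoc, add_mul]
    gcongr
  | mul x y hx hy =>
    refine (ratSize_mul_le _ _).trans ?_
    rw [valWeight, add_mul]
    gcongr
  | div x y hx hy =>
    refine (ratSize_div_le _ _).trans ?_
    rw [valWeight, add_mul]
    gcongr
  | floor x hx => exact (ratSize_floor_le _).trans hx

theorem cost_le (hs : s.Bounded b) (e : Expr) : e.cost s ≤ e.costWeight * b := by
  induction e with
  | lit q => exact Nat.le_mul_of_pos_right _ hs.pos
  | read A e ih =>
    rw [cost, costWeight, add_mul, one_mul]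
    exact add_le_add ih (hs _ _)
  | add x y hx hy =>
    rw [cost, costWeight, add_mul, add_mul]
    exact add_le_add (add_le_add hx hy) (ratSize_val_le hs (add x y))
  | sub x y hx hy =>
    rw [cost, costWeight, add_mul, add_mul]
    exact add_le_add (add_le_add hx hy) (ratSize_val_le hs (sub x y))
  | mul x y hx hy =>
    rw [cost, costWeight, add_mul, add_mul]
    exact add_le_add (add_le_add hx hy) (ratSize_val_le hs (mul x y))
  | div x y hx hy =>
    rw [cost, costWeight, add_mul, add_mul]
    exact add_le_add (add_le_add hx hy) (ratSize_val_le hs (div x y))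
  | floor x hx =>
    rw [cost, costWeight, add_mul]
    exact add_le_add hx (ratSize_val_le hs (floor x))

/-- A scratch variable, stored at position `0` of an array of its own. -/
abbrev var (A : ℕ) : Expr := .read A (.lit 0)

end Expr

namespace Program

/-- The cost of executing every instruction once, in multiples of a bound for the memory and the
time of the oracles. -/
def weight : Program → ℕ
  | .skip => 1
  | .write _ e x => 1 + e.costWeight + x.costWeight
  | .query _ e i a b δ =>
    2 + e.costWeight + i.costWeight + a.costWeight + b.costWeight + δ.costWeight
  | .seq P Q => 1 + P.weight + Q.weight
  | .ite e P Q => 1 + e.costWeight + P.weight + Q.weight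
  | .loop e P => 1 + e.costWeight + P.weight

/-- Stores `x` in the scratch variable `A`. -/
def assign (A : ℕ) (x : Expr) : Program := .write A (.lit 0) x

/-- Executes `P` with the scratch variable `A` running through `0, 1, …, bound - 1`. -/
def forLoop (A : ℕ) (bound : Expr) (P : Program) : Program :=
  .seq (assign A (.lit 0))
    (.loop (.sub bound (.var A)) (.seq P (assign A (.add (.var A) (.lit 1)))))

end Program

/-- Started on `s`, the program `P` halts with a memory satisfying `Q`, at cost at most
`P.weight * b * (N + 1)`; here `N` is a bound for the number of iterations of loops. -/
def Runs {n : ℕ} (σ : Fin n → Oracle) (b N : ℕ) (P : Program) (s : Store)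
    (Q : Store → Prop) : Prop :=
  ∃ s' t, Exec σ P s s' t ∧ Q s' ∧ t ≤ P.weight * b * (N + 1)

namespace Runs

variable {n : ℕ} {σ : Fin n → Oracle} {b N : ℕ} {s : Store} {P P₁ P₂ : Program}
  {Q R : Store → Prop}

theorem mono {N' : ℕ} (h : Runs σ b N P s Q) (hN : N ≤ N') (hQ : ∀ s', Q s' → R s') :
    Runs σ b N' P s R := by
  obtain ⟨s', t, hx, hs', ht⟩ := h
  exact ⟨s', t, hx, hQ _ hs', ht.trans (by gcongr)⟩

theorem write {A l : ℕ} {e x : Expr} {q : ℚ} (hs : s.Bounded b) (hl : e.val s = l)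
    (hq : x.val s = q) (h : Q (s.set A l q)) : Runs σ b N (.write A e x) s Q := by
  refine ⟨_, _, Exec.write s A e x, by rwa [hl, Nat.floor_natCast, hq], ?_⟩
  calc 1 + e.cost s + x.cost s ≤ b + e.costWeight * b + x.costWeight * b := by
        gcongr
        exacts [hs.pos, e.cost_le hs, x.cost_le hs]
    _ = (Program.write A e x).weight * b := by rw [Program.weight]; ring
    _ ≤ (Program.write A e x).weight * b * (N + 1) := Nat.le_mul_of_pos_right _ N.succ_pos

theorem query {A l : ℕ} {e i x y z : Expr} {m : Fin n} {a c δ : ℚ} (hs : s.Bounded b)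
    (hl : e.val s = l) (hm : i.val s = ((m : ℕ) : ℚ)) (ha : x.val s = a) (hc : y.val s = c)
    (hδ : z.val s = δ) (hv : ValidQuery a c δ) (ht : (σ m).time a c δ ≤ b)
    (h : Q (s.set A l ((σ m).ans a c δ))) : Runs σ b N (.query A e i x y z) s Q := by
  subst ha hc hδ
  refine ⟨_, _, Exec.query s A e i x y z m hm hv, by rwa [hl, Nat.floor_natCast], ?_⟩
  calc 1 + e.cost s + i.cost s + x.cost s + y.cost s + z.cost s +
          (σ m).time (x.val s) (y.val s) (z.val s)
      ≤ b + e.costWeight * b + i.costWeight * b + x.costWeight * b + y.costWeight * b +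
          z.costWeight * b + b := by
        gcongr
        exacts [hs.pos, e.cost_le hs, i.cost_le hs, x.cost_le hs, y.cost_le hs, z.cost_le hs]
    _ = (Program.query A e i x y z).weight * b := by rw [Program.weight]; ring
    _ ≤ (Program.query A e i x y z).weight * b * (N + 1) :=
        Nat.le_mul_of_pos_right _ N.succ_pos

theorem seq (hb : 0 < b) (h₁ : Runs σ b N P₁ s R) (h₂ : ∀ s', R s' → Runs σ b N P₂ s' Q) :
    Runs σ b N (.seq P₁ P₂) s Q := by
  obtain ⟨s₁, t₁, hx₁, hR, ht₁⟩ := h₁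
  obtain ⟨s₂, t₂, hx₂, hQ, ht₂⟩ := h₂ s₁ hR
  refine ⟨s₂, _, hx₁.seq hx₂, hQ, ?_⟩
  have hpos : 0 < b * (N + 1) := by positivity
  calc 1 + t₁ + t₂ ≤ b * (N + 1) + P₁.weight * b * (N + 1) + P₂.weight * b * (N + 1) := by
        gcongr
        exact hpos
    _ = (Program.seq P₁ P₂).weight * b * (N + 1) := by rw [Program.weight]; ring

theorem ite {e : Expr} (hs : s.Bounded b) (h₁ : 0 < e.val s → Runs σ b N P₁ s Q)
    (h₂ : e.val s ≤ 0 → Runs σ b N P₂ s Q) : Runs σ b N (.ite e P₁ P₂) s Q := by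
  have hpos : 0 < b * (N + 1) := Nat.mul_pos hs.pos N.succ_pos
  have he : e.cost s ≤ e.costWeight * b * (N + 1) :=
    (e.cost_le hs).trans (Nat.le_mul_of_pos_right _ N.succ_pos)
  have hweight : (Program.ite e P₁ P₂).weight * b * (N + 1) = b * (N + 1) +
      e.costWeight * b * (N + 1) + P₁.weight * b * (N + 1) + P₂.weight * b * (N + 1) := by
    rw [Program.weight]
    ring
  rcases lt_or_ge 0 (e.val s) with h | h
  · obtain ⟨s', t, hx, hQ, ht⟩ := h₁ h
    exact ⟨s', _, hx.ite_true h, hQ, by lia⟩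
  · obtain ⟨s', t, hx, hQ, ht⟩ := h₂ h
    exact ⟨s', _, hx.ite_false h, hQ, by lia⟩

theorem one_add_cost_add_le {e : Expr} {t : ℕ} (hs : s.Bounded b)
    (ht : t ≤ P.weight * b * (N + 1)) :
    1 + e.cost s + t ≤ (Program.loop e P).weight * b * (N + 1) := by
  have hpos : 0 < b * (N + 1) := Nat.mul_pos hs.pos N.succ_pos
  have he : e.cost s ≤ e.costWeight * b * (N + 1) :=
    (e.cost_le hs).trans (Nat.le_mul_of_pos_right _ N.succ_pos)
  calc 1 + e.cost s + t
      ≤ b * (N + 1) + e.costWeight * b * (N + 1) + P.weight * b * (N + 1) := by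
        gcongr
        exact hpos
    _ = (Program.loop e P).weight * b * (N + 1) := by rw [Program.weight]; ring

theorem loop {e : Expr} {L N' : ℕ} {Inv : ℕ → Store → Prop} (hN : (L + 1) * (N' + 1) ≤ N + 1)
    (hbd : ∀ m s, Inv m s → s.Bounded b)
    (hstep : ∀ m < L, ∀ s, Inv m s → 0 < e.val s ∧ Runs σ b N' P s (Inv (m + 1)))
    (hend : ∀ s, Inv L s → e.val s ≤ 0) (h0 : Inv 0 s) :
    Runs σ b N (.loop e P) s (Inv L) := by
  have key : ∀ d m, m + d = L → ∀ s, Inv m s → ∃ s' t, Exec σ (.loop e P) s s' t ∧ Inv L s' ∧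
      t ≤ (Program.loop e P).weight * b * ((d + 1) * (N' + 1)) := by
    intro d
    induction d with
    | zero =>
      rintro m rfl s hs
      exact ⟨s, _, Exec.loop_false (hend s hs), hs,
        (one_add_cost_add_le (P := P) (N := N') (hbd m s hs) zero_le).trans_eq
          (by rw [zero_add, one_mul])⟩
    | succ d ih =>
      intro m hm s hs
      obtain ⟨hpos, s₁, t₁, hx₁, hs₁, ht₁⟩ := hstep m (by lia) s hs
      obtain ⟨s₂, t₂, hx₂, hs₂, ht₂⟩ := ih (m + 1) (by lia) s₁ hs₁
      refine ⟨s₂, _, Exec.loop_true hpos hx₁ hx₂, hs₂, ?_⟩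
      exact (add_le_add (one_add_cost_add_le (hbd m s hs) ht₁) ht₂).trans_eq (by ring)
  obtain ⟨s', t, hx, hs', ht⟩ := key L 0 (zero_add L) s h0
  exact ⟨s', t, hx, hs', ht.trans (by gcongr)⟩

theorem write_seq {A l : ℕ} {e x : Expr} {q : ℚ} (hs : s.Bounded b) (hl : e.val s = l)
    (hq : x.val s = q) (h : Runs σ b N P (s.set A l q) Q) :
    Runs σ b N (.seq (.write A e x) P) s Q :=
  seq (R := (· = s.set A l q)) hs.pos (write hs hl hq rfl) fun _ hs' => hs' ▸ h

theorem assign {A : ℕ} {x : Expr} {q : ℚ} (hs : s.Bounded b) (hq : x.val s = q)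
    (h : Q (s.set A 0 q)) : Runs σ b N (.assign A x) s Q :=
  write hs Nat.cast_zero.symm hq h

theorem assign_seq {A : ℕ} {x : Expr} {q : ℚ} (hs : s.Bounded b) (hq : x.val s = q)
    (h : Runs σ b N P (s.set A 0 q) Q) : Runs σ b N (.seq (.assign A x) P) s Q :=
  write_seq hs Nat.cast_zero.symm hq h

theorem forLoop {A L N' : ℕ} {bound : Expr} {Inv : ℕ → Store → Prop}
    (hN : (L + 1) * (N' + 1) ≤ N + 1) (hL : ratSize L ≤ b) (hbd : ∀ m s, Inv m s → s.Bounded b)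
    (hbound : ∀ m s, Inv m s → bound.val s = L)
    (hset : ∀ m s q, ratSize q ≤ b → Inv m s → Inv m (s.set A 0 q))
    (hstep : ∀ m < L, ∀ s, Inv m s → s A 0 = m →
      Runs σ b N' P s fun s' => Inv (m + 1) s' ∧ s' A 0 = m) (h0 : Inv 0 s) :
    Runs σ b N (.forLoop A bound P) s (Inv L) := by
  have hbd0 := hbd 0 s h0
  have hsize : ∀ m ≤ L, ratSize m ≤ b := fun m hm => (ratSize_natCast_mono hm).trans hL
  have htest : ∀ m s, Inv m s → s A 0 = m →
      Expr.val s (.sub bound (.var A)) = L - m := by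
    intro m s hs hA
    rw [Expr.val, hbound m s hs, Expr.val, Expr.val, Nat.floor_zero, hA]
  have hzero : ratSize (0 : ℚ) ≤ b := by exact_mod_cast hsize 0 zero_le
  refine assign_seq hbd0 rfl (mono (loop (Inv := fun m s => Inv m s ∧ s A 0 = m) hN
    (fun m s hs => hbd m s hs.1) ?_ ?_ ?_) le_rfl fun s' hs' => hs'.1)
  · intro m hm s hs
    refine ⟨?_, seq hbd0.pos (hstep m hm s hs.1 hs.2) fun s' hs' =>
      assign (q := (m + 1 : ℕ)) (hbd _ _ hs'.1) ?_
        ⟨hset _ _ _ (hsize _ hm) hs'.1, Store.set_self _ _ _ _⟩⟩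
    · rw [htest m s hs.1 hs.2, sub_pos]
      exact_mod_cast hm
    · rw [Expr.val, Expr.val, Expr.val, Expr.val, Nat.floor_zero, hs'.2]
      push_cast
      rfl
  · intro s hs
    rw [htest L s hs.1 hs.2, sub_self]
  · exact ⟨hset _ _ _ hzero h0, (Store.set_self _ _ _ _).trans Nat.cast_zero.symm⟩

end Runs

/-! ## The program -/

namespace Reduction

/-- The dimension `n`. -/
abbrev dim : Expr := .read 0 (.lit 0)
/-- The cover size `k`. -/
abbrev coverSize : Expr := .read 0 (.lit 1)
/-- The lower bound `α` for the means. -/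
abbrev meanBound : Expr := .read 0 (.lit 2)
/-- The parameter `γ`. -/
abbrev param : Expr := .read 0 (.lit 3)
/-- The accuracy `ε`. -/
abbrev eps : Expr := .var 6
/-- The number of powers below `1` found so far, which finally is `M`. -/
abbrev count : Expr := .var 7
/-- The next power `ε α (1 + ε)^m`. -/
abbrev power : Expr := .var 8
/-- The current coordinate of the cube. -/
abbrev row : Expr := .var 9
/-- The current grid point. -/
abbrev col : Expr := .var 10
/-- The sum of the oracle answers. -/
abbrev total : Expr := .var 11
/-- The preceding grid point. -/
abbrev prev : Expr := .var 12
/-- The number `M + 2` of grid points. -/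
abbrev gridSize : Expr := .add count (.lit 2)

/-- Computes the accuracy. -/
def setEps : Program :=
  .ite (.sub param (.lit 1))
    (.assign 6 (.div (.lit 1) (.mul (.lit 60) dim)))
    (.assign 6 (.div param (.mul (.lit 60) dim)))

/-- Stores one more power in the grid. -/
def gridStep : Program :=
  .seq (.write 3 (.add count (.lit 1)) power)
    (.seq (.assign 7 (.add count (.lit 1)))
      (.assign 8 (.mul power (.add (.lit 1) eps))))

/-- Computes the grid; `0` is already in place. -/
def grid : Program :=
  .seq (.assign 8 (.mul eps meanBound))
    (.seq (.loop (.sub (.lit 1) power) gridStep)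
      (.write 3 (.add count (.lit 1)) (.lit 1)))

/-- Queries the mass of one cell; the answers are collected in array `13`. -/
def queryStep : Program :=
  .seq (.query 13 col row prev (.read 3 col) eps)
    (.seq (.assign 11 (.add total (.read 13 col)))
      (.assign 12 (.read 3 col)))

/-- Normalizes one oracle answer. -/
def normalizeStep : Program :=
  .write 4 (.add (.mul row gridSize) col) (.div (.read 13 col) total)

/-- Computes the distribution of one coordinate and copies its cost. -/
def rowStep : Program :=
  .seq (.assign 11 (.lit 0))
    (.seq (.assign 12 (.lit (-1)))
      (.seq (.forLoop 10 gridSize queryStep)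
        (.seq (.forLoop 10 gridSize normalizeStep)
          (.write 5 row (.read 1 row)))))

/-- Stores `n`, `k` and `M`. -/
def header : Program :=
  .seq (.write 2 (.lit 0) dim)
    (.seq (.write 2 (.lit 1) coverSize)
      (.write 2 (.lit 2) count))

/-- Computes the reduced instance. -/
def program : Program :=
  .seq setEps (.seq grid (.seq (.forLoop 9 dim rowStep) header))

end Reduction

/-! ## Correctness of the program -/

/-- All numbers that occur in the reduction have encoding length at most `b`, and the oracles
answer in time `b`. -/
structure SizeBound {n : ℕ} (I : Instance n) (γ ε : ℚ) (b : ℕ) : Prop where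
  input : (inputStore I γ).Bounded b
  eps : ratSize ε ≤ b
  count : ratSize (queryCount ε I.α + 2 : ℕ) ≤ b
  power : ∀ m ≤ queryCount ε I.α, ratSize (ε * I.α * (1 + ε) ^ m) ≤ b
  coord : ∀ l, ratSize (queryCoord ε I.α l) ≤ b
  weight : ∀ i, ∀ l ∈ Finset.range (queryCount ε I.α + 2),
    ratSize (queryWeight (I.oracle i) ε I.α l) ≤ b
  sum : ∀ i, ∀ m ≤ queryCount ε I.α + 2,
    ratSize (∑ l ∈ Finset.range m, queryWeight (I.oracle i) ε I.α l) ≤ b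
  prob : ∀ i, ∀ l ∈ Finset.range (queryCount ε I.α + 2),
    ratSize (queryProb (I.oracle i) ε I.α l) ≤ b
  time : ∀ i, ∀ l ∈ Finset.range (queryCount ε I.α + 2),
    (I.oracle i).time (queryPrev ε I.α l) (queryCoord ε I.α l) ε ≤ b

section Correctness

variable {n : ℕ} {I : Instance n} {γ ε : ℚ} {b : ℕ} {s : Store}

theorem eq_and_eq_of_mul_add_eq_mul_add {d i j l m : ℕ} (hl : l < d) (hm : m < d)
    (h : i * d + l = j * d + m) : i = j ∧ l = m := by
  have hd : 0 < d := Nat.zero_lt_of_lt hl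
  have hi := (Nat.div_mod_unique hd).2 ⟨(by ring : l + d * i = i * d + l), hl⟩
  have hj := (Nat.div_mod_unique hd).2 ⟨(by ring : m + d * j = j * d + m), hm⟩
  rw [← h] at hj
  exact ⟨hi.1.symm.trans hj.1, hi.2.symm.trans hj.2⟩

theorem inputStore_cost (I : Instance n) (γ : ℚ) (i : Fin n) : inputStore I γ 1 i = I.c i :=
  dif_pos i.2

/-- The input and the accuracy are in place. -/
structure BaseInv (I : Instance n) (γ ε : ℚ) (b : ℕ) (s : Store) : Prop where
  bounded : s.Bounded b
  input : ∀ A < 2, s A = inputStore I γ A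
  eps : s 6 0 = ε

theorem BaseInv.dim (h : BaseInv I γ ε b s) : s 0 0 = n := by rw [h.input 0 two_pos]; rfl

theorem BaseInv.coverSize (h : BaseInv I γ ε b s) : s 0 1 = I.k := by rw [h.input 0 two_pos]; rfl

theorem BaseInv.meanBound (h : BaseInv I γ ε b s) : s 0 2 = I.α := by rw [h.input 0 two_pos]; rfl

theorem BaseInv.cost (h : BaseInv I γ ε b s) (i : Fin n) : s 1 i = I.c i := by
  rw [h.input 1 one_lt_two, inputStore_cost]

theorem BaseInv.set (h : BaseInv I γ ε b s) {A l : ℕ} {q : ℚ} (hA : 2 ≤ A) (h6 : A ≠ 6)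
    (hq : ratSize q ≤ b) : BaseInv I γ ε b (s.set A l q) where
  bounded := h.bounded.set hq
  input A' hA' := by rw [Store.set_of_ne (by lia), h.input A' hA']
  eps := by rw [Store.set_of_ne h6.symm, h.eps]

/-- The invariant of the loop that computes the grid. -/
structure GridLoopInv (I : Instance n) (γ ε : ℚ) (b m : ℕ) (s : Store) : Prop
    extends BaseInv I γ ε b s where
  count : s 7 0 = m
  power : s 8 0 = ε * I.α * (1 + ε) ^ m
  coord : ∀ l ≤ m, s 3 l = queryCoord ε I.α l

/-- The grid is in place. -/
structure GridInv (I : Instance n) (γ ε : ℚ) (b : ℕ) (s : Store) : Prop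
    extends BaseInv I γ ε b s where
  count : s 7 0 = queryCount ε I.α
  coord : ∀ l < queryCount ε I.α + 2, s 3 l = queryCoord ε I.α l

/-- The grid, the first `p` probabilities in row-major order and the first `r` costs are in
place. -/
structure RowsInv (I : Instance n) (γ ε : ℚ) (b p r : ℕ) (s : Store) : Prop
    extends GridInv I γ ε b s where
  prob : ∀ i : Fin n, ∀ l < queryCount ε I.α + 2, i * (queryCount ε I.α + 2) + l < p →
    s 4 (i * (queryCount ε I.α + 2) + l) = queryProb (I.oracle i) ε I.α l
  outCost : ∀ i : Fin n, i < r → s 5 i = I.c i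

theorem RowsInv.set {p r : ℕ} (h : RowsInv I γ ε b p r s) {A l : ℕ} {q : ℚ} (hA : 8 ≤ A)
    (hq : ratSize q ≤ b) : RowsInv I γ ε b p r (s.set A l q) where
  toBaseInv := h.toBaseInv.set (by lia) (by lia) hq
  count := by rw [Store.set_of_ne (by lia), h.count]
  coord := by rw [Store.set_of_ne (by lia)]; exact h.coord
  prob := by rw [Store.set_of_ne (by lia)]; exact h.prob
  outCost := by rw [Store.set_of_ne (by lia)]; exact h.outCost

theorem RowsInv.runs_writeCost {i : Fin n} {p N : ℕ} (h : RowsInv I γ ε b p i s)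
    (hrow : s 9 0 = (i : ℕ)) :
    Runs I.oracle b N (.write 5 Reduction.row (.read 1 Reduction.row)) s
      fun s' => RowsInv I γ ε b p (i + 1) s' ∧ s' 9 0 = (i : ℕ) := by
  have hcost : ratSize (I.c i) ≤ b := by rw [← h.cost i]; exact h.bounded _ _
  refine Runs.write (l := i) (q := I.c i) h.bounded (by simp [Expr.val, hrow])
    (by simp [Expr.val, hrow, h.cost])
    ⟨⟨⟨h.toBaseInv.set (by lia) (by lia) hcost, ?_, ?_⟩, ?_, fun j hj => ?_⟩, ?_⟩
  · rw [Store.set_of_ne (by lia), h.count]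
  · rw [Store.set_of_ne (by lia)]; exact h.coord
  · rw [Store.set_of_ne (by lia)]; exact h.prob
  · rcases (Nat.le_of_lt_succ hj).lt_or_eq with hj | hj
    · rw [Store.set_entry_of_ne hj.ne, h.outCost j hj]
    · rw [Fin.ext hj, Store.set_self]
  · rw [Store.set_of_ne (by lia), hrow]

/-- The invariant of the loop that queries the oracle of coordinate `i`. -/
structure QueryInv (I : Instance n) (γ ε : ℚ) (b : ℕ) (i : Fin n) (m : ℕ) (s : Store) : Prop
    extends RowsInv I γ ε b (i * (queryCount ε I.α + 2)) i s where
  row : s 9 0 = (i : ℕ)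
  total : s 11 0 = ∑ l ∈ Finset.range m, queryWeight (I.oracle i) ε I.α l
  prev : s 12 0 = queryPrev ε I.α m
  answer : ∀ l < m, s 13 l = queryWeight (I.oracle i) ε I.α l

theorem QueryInv.set_col {i : Fin n} {m : ℕ} (h : QueryInv I γ ε b i m s) {q : ℚ}
    (hq : ratSize q ≤ b) : QueryInv I γ ε b i m (s.set 10 0 q) where
  toRowsInv := h.toRowsInv.set (by lia) hq
  row := by rw [Store.set_of_ne (by lia), h.row]
  total := by rw [Store.set_of_ne (by lia), h.total]
  prev := by rw [Store.set_of_ne (by lia), h.prev]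
  answer := by rw [Store.set_of_ne (by lia)]; exact h.answer

/-- The invariant of the loop that normalizes the answers of the oracle of coordinate `i`. -/
structure NormalizeInv (I : Instance n) (γ ε : ℚ) (b : ℕ) (i : Fin n) (m : ℕ) (s : Store) : Prop
    extends RowsInv I γ ε b (i * (queryCount ε I.α + 2) + m) i s where
  row : s 9 0 = (i : ℕ)
  total : s 11 0 = ∑ l ∈ Finset.range (queryCount ε I.α + 2), queryWeight (I.oracle i) ε I.α l
  answer : ∀ l < queryCount ε I.α + 2, s 13 l = queryWeight (I.oracle i) ε I.α l

theorem NormalizeInv.set_col {i : Fin n} {m : ℕ} (h : NormalizeInv I γ ε b i m s) {q : ℚ}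
    (hq : ratSize q ≤ b) : NormalizeInv I γ ε b i m (s.set 10 0 q) where
  toRowsInv := h.toRowsInv.set (by lia) hq
  row := by rw [Store.set_of_ne (by lia), h.row]
  total := by rw [Store.set_of_ne (by lia), h.total]
  answer := by rw [Store.set_of_ne (by lia)]; exact h.answer

namespace SizeBound

variable {N : ℕ}

theorem natCast_count (hb : SizeBound I γ ε b) {m : ℕ} (hm : m ≤ queryCount ε I.α + 2) :
    ratSize m ≤ b :=
  (ratSize_natCast_mono hm).trans hb.count

theorem one (hb : SizeBound I γ ε b) : ratSize 1 ≤ b := by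
  exact_mod_cast hb.natCast_count (m := 1) (by lia)

theorem runs_setEps (hb : SizeBound I γ (accuracy n γ) b) :
    Runs I.oracle b N Reduction.setEps (inputStore I γ)
      (· = (inputStore I γ).set 6 0 (accuracy n γ)) := by
  have hdim : inputStore I γ 0 0 = n := rfl
  have hparam : inputStore I γ 0 3 = γ := rfl
  refine Runs.ite hb.input (fun h => ?_) fun h => ?_
  · have hγ : 1 < γ := by simpa [Expr.val, hparam] using h
    refine Runs.assign hb.input ?_ rfl
    simp [Expr.val, hdim, accuracy, min_eq_right hγ.le]
  · have hγ : γ ≤ 1 := by simpa [Expr.val, hparam] using h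
    refine Runs.assign hb.input ?_ rfl
    simp [Expr.val, hdim, hparam, accuracy, min_eq_left hγ]

theorem runs_gridStep (hb : SizeBound I γ ε b) {m : ℕ} (hm : m < queryCount ε I.α)
    (h : GridLoopInv I γ ε b m s) :
    Runs I.oracle b N Reduction.gridStep s (GridLoopInv I γ ε b (m + 1)) := by
  have hbase := h.toBaseInv.set (A := 3) (l := m + 1) (by lia) (by lia) (hb.coord (m + 1))
  have hbase' := hbase.set (A := 7) (l := 0) (by lia) (by lia)
    (hb.natCast_count (m := m + 1) (by lia))
  refine Runs.write_seq (l := m + 1) (q := queryCoord ε I.α (m + 1)) h.bounded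
    (by simp [Expr.val, h.count]) (by simp [Expr.val, h.power, queryCoord_succ_of_lt hm]) ?_
  refine Runs.assign_seq (q := (m + 1 : ℕ)) hbase.bounded
    (by simp [Expr.val, Store.set_of_ne, h.count]) ?_
  refine Runs.assign (q := ε * I.α * (1 + ε) ^ (m + 1)) hbase'.bounded
    (by simp [Expr.val, Store.set_of_ne, h.power, h.eps, pow_succ, mul_assoc]) ?_
  refine ⟨hbase'.set (by lia) (by lia) (hb.power (m + 1) hm), ?_, Store.set_self _ _ _ _,
    fun l hl => ?_⟩
  · simp [Store.set_of_ne, Store.set_self]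
  · rcases hl.lt_or_eq with hl | rfl
    · simp [Store.set_of_ne, Store.set_entry_of_ne hl.ne, h.coord l (by lia)]
    · simp [Store.set_of_ne, Store.set_self]

theorem runs_grid (hb : SizeBound I γ ε b) (hε : 0 < ε) (hN : queryCount ε I.α ≤ N)
    (hbase : BaseInv I γ ε b s) (hcount : s 7 0 = 0) (hcoord : s 3 0 = 0) :
    Runs I.oracle b N Reduction.grid s (GridInv I γ ε b) := by
  have htest : ∀ m s, GridLoopInv I γ ε b m s →
      Expr.val s (.sub (.lit 1) Reduction.power) = 1 - ε * I.α * (1 + ε) ^ m := by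
    intro m s h
    simp [Expr.val, h.power]
  have hstart := hbase.set (A := 8) (l := 0) (by lia) (by lia) (hb.power 0 zero_le)
  refine Runs.assign_seq (q := ε * I.α * (1 + ε) ^ 0) hbase.bounded
    (by simp [Expr.val, hbase.eps, hbase.meanBound]) ?_
  refine Runs.seq (R := GridLoopInv I γ ε b (queryCount ε I.α)) hstart.bounded.pos
    (Runs.loop (N' := 0) (by lia) (fun m s h => h.bounded) (fun m hm s h => ⟨?_, ?_⟩)
      (fun s h => ?_) ⟨hstart, ?_, Store.set_self _ _ _ _, ?_⟩) fun s h => ?_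
  · rw [htest m s h, sub_pos, ← not_le, ← queryCount_le_iff hε I.α_pos]
    exact hm.not_ge
  · exact hb.runs_gridStep hm h
  · rw [htest _ s h, sub_nonpos]
    exact (queryCount_le_iff hε I.α_pos).1 le_rfl
  · rw [Store.set_of_ne (by lia), hcount, Nat.cast_zero]
  · intro l hl
    rw [Nat.le_zero.1 hl, Store.set_of_ne (by lia), hcoord, queryCoord_zero]
  · refine Runs.write (l := queryCount ε I.α + 1) (q := 1) h.bounded
      (by simp [Expr.val, h.count]) rfl
      ⟨h.toBaseInv.set (by lia) (by lia) hb.one, by rw [Store.set_of_ne (by lia), h.count],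
        fun l hl => ?_⟩
    rcases (Nat.le_of_lt_succ hl).lt_or_eq with hl | rfl
    · rw [Store.set_entry_of_ne hl.ne, h.coord l (by lia)]
    · rw [Store.set_self, queryCoord_of_lt (Nat.lt_succ_self _)]

theorem runs_queryStep (hb : SizeBound I γ ε b) (hε : 0 < ε) (hε1 : ε < 1) {i : Fin n} {m : ℕ}
    (hm : m < queryCount ε I.α + 2) (h : QueryInv I γ ε b i m s) (hcol : s 10 0 = m) :
    Runs I.oracle b N Reduction.queryStep s
      fun s' => QueryInv I γ ε b i (m + 1) s' ∧ s' 10 0 = m := by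
  have hrange := Finset.mem_range.2 hm
  have hcoord := h.coord m hm
  have hrows := h.toRowsInv.set (A := 13) (l := m) (by lia) (hb.weight i m hrange)
  have hrows' := hrows.set (A := 11) (l := 0) (by lia) (hb.sum i (m + 1) hm)
  refine Runs.seq (R := (· = s.set 13 m (queryWeight (I.oracle i) ε I.α m))) h.bounded.pos
    (Runs.query (m := i) h.bounded (by simp [Expr.val, hcol]) (by simp [Expr.val, h.row])
      (by simp [Expr.val, h.prev]) (by simp [Expr.val, hcol, hcoord]) (by simp [Expr.val, h.eps])
      (validQuery_queryCoord hε hε1 I.α_pos (by lia)) (hb.time i m hrange) rfl) ?_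
  rintro _ rfl
  refine Runs.assign_seq (q := ∑ l ∈ Finset.range (m + 1), queryWeight (I.oracle i) ε I.α l)
    hrows.bounded
    (by simp [Expr.val, Store.set_of_ne, Store.set_self, h.total, hcol,
      Finset.sum_range_succ]) ?_
  refine Runs.assign (q := queryCoord ε I.α m) hrows'.bounded
    (by simp [Expr.val, Store.set_of_ne, hcol, hcoord])
    ⟨⟨hrows'.set (by lia) (hb.coord m), ?_, ?_, ?_, fun l hl => ?_⟩, ?_⟩
  · simp [Store.set_of_ne, h.row]
  · simp [Store.set_of_ne, Store.set_self]
  · rw [Store.set_self, queryPrev_succ]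
  · rcases (Nat.le_of_lt_succ hl).lt_or_eq with hl | rfl
    · simp [Store.set_of_ne, Store.set_entry_of_ne hl.ne, h.answer l hl]
    · simp [Store.set_of_ne, Store.set_self]
  · simp [Store.set_of_ne, hcol]

theorem runs_normalizeStep (hb : SizeBound I γ ε b) {i : Fin n} {m : ℕ}
    (hm : m < queryCount ε I.α + 2) (h : NormalizeInv I γ ε b i m s) (hcol : s 10 0 = m) :
    Runs I.oracle b N Reduction.normalizeStep s
      fun s' => NormalizeInv I γ ε b i (m + 1) s' ∧ s' 10 0 = m := by
  have hgrid : ∀ A, A ≠ 4 → ∀ q, s.set 4 (i * (queryCount ε I.α + 2) + m) q A = s A :=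
    fun A hA q => Store.set_of_ne hA
  refine Runs.write (l := i * (queryCount ε I.α + 2) + m)
    (q := queryProb (I.oracle i) ε I.α m) h.bounded
    (by simp [Expr.val, hcol, h.row, h.count])
    (by simp [Expr.val, hcol, h.total, h.answer m hm, queryProb])
    ⟨⟨⟨⟨h.toBaseInv.set (by lia) (by lia) (hb.prob i m (Finset.mem_range.2 hm)), ?_, ?_⟩,
      fun j l hl hlt => ?_, ?_⟩, ?_, ?_, ?_⟩, ?_⟩
  · rw [hgrid _ (by lia), h.count]
  · rw [hgrid _ (by lia)]; exact h.coord
  · by_cases heq : j * (queryCount ε I.α + 2) + l = i * (queryCount ε I.α + 2) + m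
    · obtain ⟨hji, rfl⟩ := eq_and_eq_of_mul_add_eq_mul_add hl hm heq
      obtain rfl := Fin.ext hji
      exact Store.set_self _ _ _ _
    · rw [Store.set_entry_of_ne heq]
      exact h.prob j l hl (by lia)
  · rw [hgrid _ (by lia)]; exact h.outCost
  · rw [hgrid _ (by lia), h.row]
  · rw [hgrid _ (by lia), h.total]
  · rw [hgrid _ (by lia)]; exact h.answer
  · rw [hgrid _ (by lia), hcol]

theorem runs_queries (hb : SizeBound I γ ε b) (hε : 0 < ε) (hε1 : ε < 1) {i : Fin n}
    (hN : queryCount ε I.α + 2 ≤ N) (h : QueryInv I γ ε b i 0 s) :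
    Runs I.oracle b N (.forLoop 10 Reduction.gridSize Reduction.queryStep) s
      (QueryInv I γ ε b i (queryCount ε I.α + 2)) :=
  Runs.forLoop (N' := 0) (by lia) hb.count (fun m s h => h.bounded)
    (fun m s h => by simp [Expr.val, h.count]) (fun m s q hq h => h.set_col hq)
    (fun m hm s h hcol => hb.runs_queryStep hε hε1 hm h hcol) h

theorem runs_normalize (hb : SizeBound I γ ε b) {i : Fin n} (hN : queryCount ε I.α + 2 ≤ N)
    (h : NormalizeInv I γ ε b i 0 s) :
    Runs I.oracle b N (.forLoop 10 Reduction.gridSize Reduction.normalizeStep) s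
      (NormalizeInv I γ ε b i (queryCount ε I.α + 2)) :=
  Runs.forLoop (N' := 0) (by lia) hb.count (fun m s h => h.bounded)
    (fun m s h => by simp [Expr.val, h.count]) (fun m s q hq h => h.set_col hq)
    (fun m hm s h hcol => hb.runs_normalizeStep hm h hcol) h

theorem runs_rowStep (hb : SizeBound I γ ε b) (hε : 0 < ε) (hε1 : ε < 1) {i : Fin n}
    (hN : queryCount ε I.α + 2 ≤ N)
    (h : RowsInv I γ ε b (i * (queryCount ε I.α + 2)) i s) (hrow : s 9 0 = (i : ℕ)) :
    Runs I.oracle b N Reduction.rowStep s fun s' =>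
      RowsInv I γ ε b ((i + 1) * (queryCount ε I.α + 2)) (i + 1) s' ∧ s' 9 0 = (i : ℕ) := by
  have hzero : ratSize 0 ≤ b := by exact_mod_cast hb.natCast_count (m := 0) zero_le
  have hprev : ratSize (-1) ≤ b := (ratSize_neg 1).trans_le hb.one
  have h₁ := h.set (A := 11) (l := 0) (by lia) hzero
  have h₂ := h₁.set (A := 12) (l := 0) (by lia) hprev
  refine Runs.assign_seq (q := 0) h.bounded rfl (Runs.assign_seq (q := -1) h₁.bounded rfl ?_)
  refine Runs.seq h.bounded.pos (hb.runs_queries (i := i) hε hε1 hN ⟨h₂, ?_, ?_, ?_, ?_⟩)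
    fun s h => Runs.seq h.bounded.pos
      (hb.runs_normalize (i := i) hN ⟨h.toRowsInv, h.row, h.total, h.answer⟩)
      fun s h => (h.toRowsInv.runs_writeCost h.row).mono le_rfl fun s' h' => ?_
  · simp [Store.set_of_ne, hrow]
  · simp [Store.set_of_ne, Store.set_self]
  · rw [Store.set_self, queryPrev_zero]
  · exact fun l hl => absurd hl l.not_lt_zero
  · rwa [add_one_mul (i : ℕ)]

theorem runs_rows (hb : SizeBound I γ ε b) (hε : 0 < ε) (hε1 : ε < 1)
    (hN : (n + 1) * (queryCount ε I.α + 3) ≤ N) (h : RowsInv I γ ε b 0 0 s) :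
    Runs I.oracle b N (.forLoop 9 Reduction.dim Reduction.rowStep) s
      (RowsInv I γ ε b (n * (queryCount ε I.α + 2)) n) := by
  refine Runs.forLoop (N' := queryCount ε I.α + 2)
    (Inv := fun r => RowsInv I γ ε b (r * (queryCount ε I.α + 2)) r) (by lia)
    (hb.input 0 0) (fun r s h => h.bounded) (fun r s h => by simp [Expr.val, h.dim])
    (fun r s q hq h => h.set (by lia) hq)
    (fun r hr s h hrow => hb.runs_rowStep (i := ⟨r, hr⟩) hε hε1 le_rfl h hrow) ?_
  rwa [zero_mul]

theorem runs_header {hn : 1 ≤ n} {hγ : 0 < γ} (hb : SizeBound I γ (accuracy n γ) b)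
    (h : RowsInv I γ (accuracy n γ) b (n * (queryCount (accuracy n γ) I.α + 2)) n s) :
    Runs I.oracle b N Reduction.header s fun s' => s'.Holds (I.reduced hn hγ) := by
  have h₁ := h.toBaseInv.set (A := 2) (l := 0) (q := n) le_rfl (by lia) (hb.input 0 0)
  have h₂ := h₁.set (A := 2) (l := 1) (q := I.k) le_rfl (by lia) (hb.input 0 1)
  refine Runs.write_seq (l := 0) (q := n) h.bounded (by simp [Expr.val])
    (by simp [Expr.val, h.dim]) ?_
  refine Runs.write_seq (l := 1) (q := I.k) h₁.bounded (by simp [Expr.val])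
    (by simp [Expr.val, h₁.coverSize]) ?_
  refine Runs.write (l := 2) (q := queryCount (accuracy n γ) I.α) h₂.bounded (by simp [Expr.val])
    (by simp [Expr.val, Store.set_of_ne, h.count]) ⟨?_, ?_, ?_, fun j => ?_, fun i j => ?_, ?_⟩
  · simp [Store.set_entry_of_ne, Store.set_self]
  · rw [Store.set_entry_of_ne (by lia), Store.set_self]
    rfl
  · exact Store.set_self _ _ _ _
  · rw [Store.set_of_ne (by lia), Store.set_of_ne (by lia), Store.set_of_ne (by lia)]
    exact h.coord j j.2
  · have hlt : i * (queryCount (accuracy n γ) I.α + 2) + (j : ℕ) <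
        n * (queryCount (accuracy n γ) I.α + 2) := by
      calc _ < (i + 1) * (queryCount (accuracy n γ) I.α + 2) := by
            rw [add_one_mul]; exact Nat.add_lt_add_left j.2 _
        _ ≤ _ := Nat.mul_le_mul_right _ i.2
    rw [Store.set_of_ne (by lia), Store.set_of_ne (by lia), Store.set_of_ne (by lia)]
    exact h.prob i j j.2 hlt
  · rw [Store.set_of_ne (by lia), Store.set_of_ne (by lia), Store.set_of_ne (by lia)]
    exact fun i => h.outCost i i.2

theorem runs_program (hb : SizeBound I γ (accuracy n γ) b) (hn : 1 ≤ n) (hγ : 0 < γ) :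
    Runs I.oracle b ((n + 1) * (queryCount (accuracy n γ) I.α + 3)) Reduction.program
      (inputStore I γ) fun s => s.Holds (I.reduced hn hγ) := by
  have hε := accuracy_pos hn hγ
  have hε1 := accuracy_lt_one hn γ
  have hpos := hb.input.pos
  refine Runs.seq hpos hb.runs_setEps ?_
  rintro _ rfl
  have hbase : BaseInv I γ (accuracy n γ) b ((inputStore I γ).set 6 0 (accuracy n γ)) :=
    ⟨hb.input.set hb.eps, fun A hA => Store.set_of_ne (by lia), Store.set_self _ _ _ _⟩
  refine Runs.seq hpos (hb.runs_grid hε (by nlinarith) hbase rfl rfl) fun s h => ?_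
  exact Runs.seq hpos (hb.runs_rows hε hε1 le_rfl
    ⟨h, fun i l _ hl => absurd hl (Nat.not_lt_zero _), fun i hi => absurd hi (Nat.not_lt_zero _)⟩)
    fun s h => hb.runs_header h

end SizeBound

end Correctness

/-! ## Polynomial bounds -/

theorem polynomial_eval_mono (P : Polynomial ℕ) : Monotone fun x => P.eval x := by
  intro x y h
  simp only [Polynomial.eval_eq_sum]
  exact Finset.sum_le_sum fun i _ => Nat.mul_le_mul_left _ (Nat.pow_le_pow_left h i)

section SizeInput

variable {n : ℕ}

theorem dim_le_size (I : Instance n) : n ≤ I.size := by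
  have h := Finset.card_nsmul_le_sum Finset.univ _ 1 fun i _ => one_le_ratSize (I.c i)
  rw [Finset.card_univ, Fintype.card_fin, smul_eq_mul, mul_one] at h
  unfold Instance.size
  lia

theorem ratSize_cost_le_size (I : Instance n) (i : Fin n) : ratSize (I.c i) ≤ I.size := by
  have h := Finset.single_le_sum (f := fun i => ratSize (I.c i)) (fun _ _ => Nat.zero_le _)
    (Finset.mem_univ i)
  unfold Instance.size
  lia

theorem bounded_inputStore (I : Instance n) (γ : ℚ) :
    (inputStore I γ).Bounded (I.size + ratSize γ + 2) := by
  have hzero : ratSize 0 = 2 := by exact_mod_cast ratSize_natCast 0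
  intro A l
  unfold inputStore
  split
  · rw [ratSize_natCast]
    unfold Instance.size
    lia
  · rw [ratSize_natCast]
    unfold Instance.size
    lia
  · unfold Instance.size
    lia
  · lia
  · split_ifs with h
    · exact (ratSize_cost_le_size I _).trans (by lia)
    · lia
  · lia

theorem ratSize_accuracy_le (n : ℕ) (γ : ℚ) :
    ratSize (accuracy n γ) ≤ ratSize γ + 60 * n + 5 := by
  have hmin : ratSize (min γ 1) ≤ ratSize γ + 3 := by
    rcases min_choice γ 1 with h | h <;> rw [h]
    · exact Nat.le_add_right _ _
    · exact (Nat.le_add_left 3 _).trans' (by exact_mod_cast ratSize_natCast_le 1)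
  calc ratSize (accuracy n γ) ≤ ratSize (min γ 1) + ratSize (60 * n : ℚ) := ratSize_div_le _ _
    _ ≤ ratSize γ + 3 + (60 * n + 2) := by
        gcongr
        exact_mod_cast ratSize_natCast_le (60 * n)
    _ = ratSize γ + 60 * n + 5 := by ring

theorem one_le_mul_accuracy (hn : 1 ≤ n) {γ : ℚ} (hγ : 0 < γ) :
    1 ≤ ((60 * n * (⌈γ⁻¹⌉₊ + 1) : ℕ) : ℚ) * accuracy n γ := by
  have hceil : 1 ≤ (⌈γ⁻¹⌉₊ : ℚ) * γ := (inv_le_iff_one_le_mul₀ hγ).1 (Nat.le_ceil γ⁻¹)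
  calc (1 : ℚ) ≤ (⌈γ⁻¹⌉₊ + 1) * min γ 1 := by
        rcases min_choice γ 1 with h | h <;> rw [h]
        · linarith
        · linarith [Nat.cast_nonneg (α := ℚ) ⌈γ⁻¹⌉₊]
    _ = ((60 * n * (⌈γ⁻¹⌉₊ + 1) : ℕ) : ℚ) * accuracy n γ := by
        rw [← accuracy_mul hn γ]
        push_cast
        ring

end SizeInput

section SizeGrid

variable {ε α : ℚ} {e m l w : ℕ}

-- By Bernoulli's inequality `(1 + ε)^N ≥ 2`, while `ε α` is at least the inverse of its
-- denominator.
theorem queryCount_le_mul (hε : 0 < ε) (hα : 0 < α) {N : ℕ} (hN : 1 ≤ N * ε) :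
    queryCount ε α ≤ N * ratSize (ε * α) := by
  rw [queryCount_le_iff hε hα]
  have hpos : 0 < ε * α := mul_pos hε hα
  have htwo : (2 : ℚ) ≤ (1 + ε) ^ N := by
    linarith [one_add_mul_le_pow (a := ε) (by linarith) N]
  have hden : ((ε * α).den : ℚ) ≤ 2 ^ ratSize (ε * α) := by
    exact_mod_cast (Nat.lt_size_self _).le.trans
      (Nat.pow_le_pow_right two_pos (size_den_lt_ratSize (ε * α)).le)
  calc (1 : ℚ) ≤ (ε * α).num := by exact_mod_cast Rat.num_pos.2 hpos
    _ = ε * α * (ε * α).den := (Rat.mul_den_eq_num _).symm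
    _ ≤ ε * α * 2 ^ ratSize (ε * α) := by gcongr
    _ ≤ ε * α * ((1 + ε) ^ N) ^ ratSize (ε * α) := by gcongr
    _ = ε * α * (1 + ε) ^ (N * ratSize (ε * α)) := by rw [pow_mul]

/-- A bound for the encoding lengths of `ε α (1 + ε)^l`, where `l ≤ m`, if `ε` and `α` have
encoding length at most `e`. -/
def powerBound (e m : ℕ) : ℕ := 2 * e + m * (2 * e + 6) + 3

theorem ratSize_power_le (hε : ratSize ε ≤ e) (hα : ratSize α ≤ e) (hl : l ≤ m) :
    ratSize (ε * α * (1 + ε) ^ l) ≤ powerBound e m := by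
  have hone : ratSize 1 ≤ 3 := by exact_mod_cast ratSize_natCast_le 1
  calc ratSize (ε * α * (1 + ε) ^ l) ≤ ratSize (ε * α) + ratSize ((1 + ε) ^ l) :=
        ratSize_mul_le _ _
    _ ≤ (ratSize ε + ratSize α) + (l * ratSize (1 + ε) + 3) :=
        add_le_add (ratSize_mul_le _ _) (ratSize_pow_le _ _)
    _ ≤ (e + e) + (m * (2 * (3 + e)) + 3) := by
        gcongr
        exact (ratSize_add_le 1 ε).trans (by gcongr)
    _ = powerBound e m := by
        unfold powerBound
        ring

theorem ratSize_queryCoord_le (hε : ratSize ε ≤ e) (hα : ratSize α ≤ e)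
    (hm : queryCount ε α ≤ m) (l : ℕ) : ratSize (queryCoord ε α l) ≤ powerBound e m := by
  have hthree : 3 ≤ powerBound e m := Nat.le_add_left _ _
  unfold queryCoord
  split_ifs with hl hlm
  · exact le_trans (by exact_mod_cast ratSize_natCast_le 0) (hthree.trans' (by lia))
  · exact ratSize_power_le hε hα (by lia)
  · exact le_trans (by exact_mod_cast ratSize_natCast_le 1) hthree

theorem ratSize_queryPrev_le (hε : ratSize ε ≤ e) (hα : ratSize α ≤ e)
    (hm : queryCount ε α ≤ m) (l : ℕ) : ratSize (queryPrev ε α l) ≤ powerBound e m := by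
  rcases l with _ | l
  · have hone : ratSize 1 ≤ 3 := by exact_mod_cast ratSize_natCast_le 1
    rw [queryPrev_zero, ratSize_neg]
    exact hone.trans (Nat.le_add_left _ _)
  · exact ratSize_queryCoord_le hε hα hm l

theorem Oracle.RunsWithin.queryCoord_bounds {σ : Oracle} {P : Polynomial ℕ}
    (hP : σ.RunsWithin P) (hε : 0 < ε) (hε1 : ε < 1) (hα : 0 < α) (hεe : ratSize ε ≤ e)
    (hαe : ratSize α ≤ e) (hm : queryCount ε α ≤ m) (hl : l ∈ Finset.range (queryCount ε α + 2)) :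
    ratSize (queryWeight σ ε α l) ≤ P.eval (2 * powerBound e m + e) ∧
      σ.time (queryPrev ε α l) (queryCoord ε α l) ε ≤ P.eval (2 * powerBound e m + e) := by
  obtain ⟨hans, htime⟩ := hP _ _ _
    (validQuery_queryCoord hε hε1 hα (Nat.le_of_lt_succ (Finset.mem_range.1 hl)))
  have hlength := add_le_add (add_le_add (ratSize_queryPrev_le hεe hαe hm l)
    (ratSize_queryCoord_le hεe hαe hm l)) hεe
  rw [← two_mul] at hlength
  have hbound := htime.trans (polynomial_eval_mono P hlength)
  exact ⟨hans.trans hbound, hbound⟩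

/-- A bound for the encoding lengths of the partial sums of at most `m + 2` approximate
probabilities of encoding length at most `w`. -/
def sumBound (m w : ℕ) : ℕ := 2 * ((m + 2) * w + 1) + 3

theorem Oracle.Approximates.ratSize_sum_queryWeight_le {σ : Oracle} {μ : Measure unitInterval}
    [IsProbabilityMeasure μ] (h : σ.Approximates μ) (hε : 0 < ε) (hε1 : ε < 1) (hα : 0 < α)
    (hm : queryCount ε α ≤ m)
    (hw : ∀ l ∈ Finset.range (queryCount ε α + 2), ratSize (queryWeight σ ε α l) ≤ w)
    (hl : l ≤ queryCount ε α + 2) :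
    ratSize (∑ j ∈ Finset.range l, queryWeight σ ε α j) ≤ sumBound m w := by
  have hsub := Finset.range_subset_range.2 hl
  have hnonneg : ∀ j ∈ Finset.range (queryCount ε α + 2), 0 ≤ queryWeight σ ε α j :=
    fun j hj => (h.queryWeight_bounds hε hε1 hα hj).1
  have hle : ∑ j ∈ Finset.range l, queryWeight σ ε α j ≤ (2 : ℕ) :=
    calc _ ≤ ∑ j ∈ Finset.range (queryCount ε α + 2), queryWeight σ ε α j :=
          Finset.sum_le_sum_of_subset_of_nonneg hsub fun j hj _ => hnonneg j hj
      _ ≤ 1 + ε := h.sum_queryWeight_le hε hε1 hα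
      _ ≤ (2 : ℕ) := by push_cast; linarith
  have hden : Nat.size (∑ j ∈ Finset.range l, queryWeight σ ε α j).den ≤ (m + 2) * w + 1 :=
    calc _ ≤ ∑ j ∈ Finset.range l, ratSize (queryWeight σ ε α j) + 1 := size_den_sum_le _ _
      _ ≤ l * w + 1 := by
          gcongr
          simpa using Finset.sum_le_card_nsmul _ _ w fun j hj => hw j (hsub hj)
      _ ≤ (m + 2) * w + 1 := by
          gcongr
          lia
  calc _ ≤ 2 * Nat.size (∑ j ∈ Finset.range l, queryWeight σ ε α j).den + Nat.size 2 + 1 :=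
        ratSize_le_of_le_natCast (Finset.sum_nonneg fun j hj => hnonneg j (hsub hj)) hle
    _ ≤ sumBound m w := by
        have hsize : Nat.size 2 = 2 := by decide
        unfold sumBound
        lia

end SizeGrid

/-- A bound for all encoding lengths and oracle times of the reduction, if the input and the
accuracy have encoding length at most `e`, there are at most `m + 2` grid points and the oracles
run in time `P`. -/
def numberBound (P : Polynomial ℕ) (e m : ℕ) : ℕ :=
  e + (m + 4) + powerBound e m + P.eval (2 * powerBound e m + e) +
    sumBound m (P.eval (2 * powerBound e m + e))

theorem sizeBound_numberBound {n : ℕ} {I : Instance n} {γ ε : ℚ} {P : Polynomial ℕ} {e m : ℕ}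
    (hP : ∀ i, (I.oracle i).RunsWithin P) (hε : 0 < ε) (hε1 : ε < 1)
    (hinput : (inputStore I γ).Bounded e) (hεe : ratSize ε ≤ e)
    (hm : queryCount ε I.α ≤ m) : SizeBound I γ ε (numberBound P e m) := by
  have hαe : ratSize I.α ≤ e := hinput 0 2
  have hquery i l (hl : l ∈ Finset.range (queryCount ε I.α + 2)) :=
    (hP i).queryCoord_bounds hε hε1 I.α_pos hεe hαe hm hl
  have hsum : ∀ i, ∀ l ≤ queryCount ε I.α + 2,
      ratSize (∑ j ∈ Finset.range l, queryWeight (I.oracle i) ε I.α j) ≤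
        sumBound m (P.eval (2 * powerBound e m + e)) := fun i l hl =>
    have := I.isProb i
    (I.nice i).1.ratSize_sum_queryWeight_le hε hε1 I.α_pos hm (fun j hj => (hquery i j hj).1) hl
  unfold numberBound
  constructor
  · exact fun A l => (hinput A l).trans (by lia)
  · lia
  · exact (ratSize_natCast_le _).trans (by lia)
  · exact fun l hl => (ratSize_power_le hεe hαe (hl.trans hm)).trans (by lia)
  · exact fun l => (ratSize_queryCoord_le hεe hαe hm l).trans (by lia)
  · exact fun i l hl => (hquery i l hl).1.trans (by lia)
  · exact fun i l hl => (hsum i l hl).trans (by lia)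
  · exact fun i l hl => (ratSize_div_le _ _).trans
      ((add_le_add (hquery i l hl).1 (hsum i _ le_rfl)).trans (by lia))
  · exact fun i l hl => (hquery i l hl).2.trans (by lia)

theorem exists_polynomial_eval_eq_numberBound (P e m : Polynomial ℕ) :
    ∃ T : Polynomial ℕ, ∀ x, T.eval x = numberBound P (e.eval x) (m.eval x) := by
  let a := 2 * e + m * (2 * e + 6) + 3
  let w := P.comp (2 * a + e)
  refine ⟨e + (m + 4) + a + w + (2 * ((m + 2) * w + 1) + 3), fun x => ?_⟩
  simp [a, w, numberBound, powerBound, sumBound]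

theorem exists_polynomial_program (P : Polynomial ℕ) :
    ∃ T : Polynomial ℕ, ∀ (n : ℕ) (hn : 1 ≤ n) (I : Instance n)
      (_ : ∀ i, (I.oracle i).RunsWithin P) (γ : ℚ) (hγ : 0 < γ),
      ∃ (s : Store) (t : ℕ), Exec I.oracle Reduction.program (inputStore I γ) s t ∧
        s.Holds (I.reduced hn hγ) ∧ t ≤ T.eval (⌈γ⁻¹⌉₊ + I.size + ratSize γ) := by
  let e : Polynomial ℕ := 61 * .X + 5
  let m : Polynomial ℕ := 60 * .X * (.X + 1) * (2 * e)
  obtain ⟨b, hb⟩ := exists_polynomial_eval_eq_numberBound P e m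
  refine ⟨(Reduction.program.weight : Polynomial ℕ) * b * ((.X + 1) * (m + 3) + 1),
    fun n hn I hP γ hγ => ?_⟩
  set L := ⌈γ⁻¹⌉₊ + I.size + ratSize γ
  have he : e.eval L = 61 * L + 5 := by simp [e]
  have hmL : m.eval L = 60 * L * (L + 1) * (2 * e.eval L) := by simp [m]
  have hnL : n ≤ L := (dim_le_size I).trans (by lia)
  have hε := accuracy_pos hn hγ
  have hinput : (inputStore I γ).Bounded (e.eval L) := fun A l =>
    (bounded_inputStore I γ A l).trans (by lia)
  have hεe : ratSize (accuracy n γ) ≤ e.eval L := (ratSize_accuracy_le n γ).trans (by lia)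
  have hcount : queryCount (accuracy n γ) I.α ≤ m.eval L :=
    calc _ ≤ 60 * n * (⌈γ⁻¹⌉₊ + 1) * ratSize (accuracy n γ * I.α) :=
          queryCount_le_mul hε I.α_pos (one_le_mul_accuracy hn hγ)
      _ ≤ 60 * L * (L + 1) * (2 * e.eval L) := by
          gcongr
          · lia
          · exact (ratSize_mul_le _ _).trans
              ((add_le_add hεe (hinput 0 2)).trans_eq (two_mul _).symm)
      _ = m.eval L := hmL.symm
  obtain ⟨s, t, hx, hs, ht⟩ :=
    (sizeBound_numberBound hP hε (accuracy_lt_one hn γ) hinput hεe hcount).runs_program hn hγ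
  refine ⟨s, t, hx, hs, ht.trans ?_⟩
  simp only [Polynomial.eval_mul, Polynomial.eval_add, Polynomial.eval_natCast,
    Polynomial.eval_X, Polynomial.eval_ofNat, Polynomial.eval_one, Nat.cast_id, hb]
  gcongr

end ParetoCover

theorem mainTheorem5 :
    ∃ R : ParetoCover.Program,
      ∀ P : Polynomial ℕ, ∃ T : Polynomial ℕ,
        ∀ (n : ℕ) (_ : 1 ≤ n) (I : ParetoCover.Instance n)
          (_ : ∀ i, (I.oracle i).RunsWithin P) (γ : ℚ) (_ : 0 < γ),
          ∃ J : ParetoCover.DiscreteInstance n,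
            ParetoCover.IsReducedInstance I γ J ∧
            (∀ B : Finset (Fin n → unitInterval),
              ParetoCover.IsApproxSolution J.measure J.c J.k (1 + (γ : ℝ) / 15) B →
              ParetoCover.IsApproxSolution I.measure I.c I.k (1 + (γ : ℝ)) B) ∧
            ∃ (s : ParetoCover.Store) (t : ℕ),
              ParetoCover.Exec I.oracle R (ParetoCover.inputStore I γ) s t ∧
              s.Holds J ∧
              t ≤ T.eval (⌈γ⁻¹⌉₊ + I.size + ParetoCover.ratSize γ) := by
  refine ⟨ParetoCover.Reduction.program, fun P => ?_⟩
  obtain ⟨T, hT⟩ := ParetoCover.exists_polynomial_program P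
  exact ⟨T, fun n hn I hP γ hγ => ⟨I.reduced hn hγ, I.isReducedInstance_reduced hn hγ,
    fun B hB => hB.of_reduced I hn hγ, hT n hn I hP γ hγ⟩⟩
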